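/- Let $T\ge 1$ be an integer, $p\ge 1$, $s\in(0,1)$ with $sp<1$. A ($T$-periodic) configuration $\mathbf X\in\mathbb X_T$ is given by points $0\le x_1\le\dots\le x_T<T$, extended periodically to the points $x_i+kT$, $k\in\mathbb Z$, counted with multiplicity. Let $\mathbb X_T^0\subset\mathbb X_T$ be the set of configurations in which the points $x_i + kT$ are pairwise distinct. For $\mathbf X\in\mathbb X_T$ let $u=u[\mathbf X]$ be the $T$-periodic function, unique up to an additive constant, with distributional derivative $\mathrm Du=\mathcal L^1-\sum_{k\in\mathbb Z}\sum_{i=1}^T\delta_{x_i+kT}$, and set $$\mathcal F^s_p[\mathbf X]=\int_0^T\int_{\mathbb R}\frac{|u(x)-u(y)|^p}{|x-y|^{1+sp}}\,\mathrm dy\,\mathrm dx .$$ Let $\mathbf X^{\mathrm{eq}}$ be the equispaced configuration, whose points are the integers. For $\mathbf X\in\mathbb X_T$ and $h\in\mathbb R$ let $\mathbf X+he_i$ be the configuration obtained by moving $x_i$ (and its translates $x_i+kT$) by $h$. We call $\mathbf X$ critical if for every $i=1,\dots,T$ the function $h\mapsto\mathcal F^s_p[\mathbf X+he_i]$ is differentiable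 at $h=0$ with derivative $0$. We call $\mathbf X$ a local minimiser if there is $\varepsilon>0$ such that $\mathcal F^s_p[\mathbf X]\le\mathcal F^s_p[\mathbf Y]$ for every $\mathbf Y\in\mathbb X_T$ whose points can be matched with those of $\mathbf X$ modulo $T$ at distances less than $\varepsilon$, and a global minimiser if $\mathcal F^s_p[\mathbf X]\le\mathcal F^s_p[\mathbf Y]$ for all $\mathbf Y\in\mathbb X_T$. Then $\mathcal F^s_p$ is finite on all configurations, and: (1) $\mathbf X^{\mathrm{eq}}$ is, up to translation, the unique critical point of $\mathcal F^s_p$ in $\mathbb X^0_T$: a configuration $\mathbf X\in\mathbb X_T$ belongs to $\mathbb X_T^0$ and is critical if and only if $\mathbf X=\mathbf X^{\mathrm{eq}}+a$ for some $a\in\mathbb R$. (2) $\mathbf X^{\mathrm{eq}}$ is, up to translation, the unique local and the unique global minimiser of $\mathcal F^s_p$ in $\mathbb X_T$: a configuration $\mathbf X\in\mathbb X_T$ is a local minimiser if and only if $\mathbf X=\mathbf X^{\mathrm{eq}}+a$ for some $a\in\mathbb R$, and it is a global minimiser if and only if $\mathbf X=\mathbf X^{\mathrm{eq}}+a$ for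 some $a\in\mathbb R$. -/

import Mathlib

open MeasureTheory Set
open scoped ENNReal ContDiff

noncomputable section

/-- The one-dimensional energy `F^s_p(u) = ∫_{[0,T]} ∫_ℝ |u(x) - u(y)|^p / |x - y|^(1 + s p) dy dx`
of a `T`-periodic function `u`, with values in `[0, ∞]`. -/
def gagliardoEnergy (T : ℕ) (s p : ℝ) (u : ℝ → ℝ) : ℝ≥0∞ :=
  ∫⁻ x in Icc (0 : ℝ) T, ∫⁻ y : ℝ, ENNReal.ofReal (|u x - u y| ^ p / |x - y| ^ (1 + s * p))

/-- The function `u[x]` with slope `1` and one unit negative jump at every point `x i + k T`, where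
`i : Fin T` and `k : ℤ`; the additive constant is immaterial. The positions `x i` are arbitrary real
numbers, repetitions are allowed. See `jumpProfile_periodic` and `jumpProfile_hasJumpDerivative`. -/
def jumpProfile (T : ℕ) (x : Fin T → ℝ) (y : ℝ) : ℝ :=
  y - ∑ i, (⌊(y - x i) / T⌋ : ℝ)

/-- The identity `Du = ℒ¹ - ∑_{k ∈ ℤ} ∑_i δ_{x i + k T}` in the sense of distributions on `ℝ`. -/
def HasJumpDerivative (T : ℕ) (x : Fin T → ℝ) (u : ℝ → ℝ) : Prop :=
  LocallyIntegrable u ∧ ∀ φ : ℝ → ℝ, ContDiff ℝ ∞ φ → HasCompactSupport φ →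
    -∫ y, u y * deriv φ y = (∫ y, φ y) - ∑' k : ℤ, ∑ i, φ (x i + k * T)

theorem jumpProfile_periodic {T : ℕ} (hT : 0 < T) (x : Fin T → ℝ) :
    Function.Periodic (jumpProfile T x) T := by
  intro y
  have hT' : (T : ℝ) ≠ 0 := by positivity
  have h : ∀ i, ⌊(y + T - x i) / T⌋ = ⌊(y - x i) / T⌋ + 1 := by
    intro i
    rw [← Int.floor_add_one]
    congr 1
    field_simp
    ring
  simp only [jumpProfile, h]
  push_cast
  rw [Finset.sum_add_distrib]
  simp

theorem locallyIntegrable_floor_div {T : ℕ} (a : ℝ) :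
    LocallyIntegrable (fun y : ℝ => (⌊(y - a) / T⌋ : ℝ)) := by
  have h : Monotone (fun y : ℝ => (⌊(y - a) / T⌋ : ℝ)) := by
    intro y z hyz
    have : ⌊(y - a) / (T : ℝ)⌋ ≤ ⌊(z - a) / (T : ℝ)⌋ := by gcongr
    exact Int.cast_le.2 this
  exact h.locallyIntegrable

theorem integral_floor_div_mul_deriv {T : ℕ} (hT : 0 < T) (a : ℝ) {φ : ℝ → ℝ}
    (hφ : ContDiff ℝ ∞ φ) (hc : HasCompactSupport φ) :
    Summable (fun k : ℤ => φ (a + k * T)) ∧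
    ∫ y, (⌊(y - a) / T⌋ : ℝ) * deriv φ y = -∑' k : ℤ, φ (a + k * T) := by
  have hT' : (0 : ℝ) < T := by exact_mod_cast hT
  obtain ⟨R, hR⟩ : ∃ R : ℝ, ∀ y, R ≤ |y - a| → φ y = 0 ∧ deriv φ y = 0 := by
    obtain ⟨R, hR⟩ := hc.isCompact.isBounded.subset_ball a
    refine ⟨R, fun y hy => ?_⟩
    have hy' : y ∉ tsupport φ := fun h => by
      have := hR h
      rw [Metric.mem_ball, Real.dist_eq] at this
      linarith
    exact ⟨image_eq_zero_of_notMem_tsupport hy',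
      image_eq_zero_of_notMem_tsupport (fun h => hy' (tsupport_deriv_subset h))⟩
  obtain ⟨N, hN⟩ := exists_nat_gt (R / T)
  have hN' : R < N * T := by rwa [div_lt_iff₀ hT'] at hN
  have hzero : ∀ k : ℤ, k ∉ Finset.Ico (-(N : ℤ)) N → φ (a + k * T) = 0 := by
    intro k hk
    refine (hR _ ?_).1
    have : (N : ℤ) ≤ |k| := by
      rw [Finset.mem_Ico] at hk
      rcases le_abs.2 (show (N : ℤ) ≤ k ∨ (N : ℤ) ≤ -k by omega) |>.lt_or_eq with h | h <;> omega
    have h2 : (N : ℝ) ≤ |(k : ℝ)| := by exact_mod_cast this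
    have h3 : |a + k * T - a| = |(k : ℝ)| * T := by
      rw [add_sub_cancel_left, abs_mul, abs_of_pos hT']
    rw [h3]
    nlinarith
  refine ⟨summable_of_ne_finset_zero (s := Finset.Ico (-(N : ℤ)) N) (fun k hk => hzero k hk), ?_⟩
  rw [tsum_eq_sum (s := Finset.Ico (-(N : ℤ)) N) (fun k hk => hzero k hk)]
  set f : ℝ → ℝ := fun y => (⌊(y - a) / T⌋ : ℝ) * deriv φ y with hf
  have hcd : Continuous (deriv φ) := hφ.continuous_deriv (by simp)
  have hfint : Integrable f :=
    (locallyIntegrable_floor_div a).integrable_smul_right_of_hasCompactSupport hcd hc.deriv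
  let c : ℕ → ℝ := fun n => a + ((n : ℝ) - N) * T
  have hcle : ∀ n, c n ≤ c (n + 1) := by
    intro n
    simp only [c]
    push_cast
    nlinarith
  have h1 : ∫ y, f y = ∫ y in (c 0)..(c (2 * N)), f y := by
    symm
    apply intervalIntegral.integral_eq_integral_of_support_subset
    intro y hy
    by_contra hcon
    apply hy
    have : R ≤ |y - a| := by
      simp only [c, mem_Ioc, not_and_or, not_lt, not_le] at hcon
      push_cast at hcon
      rcases hcon with h | h
      · have := neg_le_abs (y - a)
        nlinarith
      · have := le_abs_self (y - a)
        nlinarith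
    simp [hf, (hR y this).2]
  have h2 : ∫ y in (c 0)..(c (2 * N)), f y
      = ∑ n ∈ Finset.range (2 * N), ((n : ℝ) - N) * (φ (c (n + 1)) - φ (c n)) := by
    rw [← intervalIntegral.sum_integral_adjacent_intervals
      (fun k _ => hfint.intervalIntegrable)]
    refine Finset.sum_congr rfl fun n _ => ?_
    rw [← intervalIntegral.integral_deriv_eq_sub' φ rfl
      (fun y _ => (hφ.differentiable (by simp)).differentiableAt) hcd.continuousOn,
      ← intervalIntegral.integral_const_mul]
    rw [intervalIntegral.integral_of_le (hcle n), intervalIntegral.integral_of_le (hcle n),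
      ← integral_Ico_eq_integral_Ioc, ← integral_Ico_eq_integral_Ioc]
    refine setIntegral_congr_fun measurableSet_Ico fun y hy => ?_
    have hfl : ⌊(y - a) / (T : ℝ)⌋ = (n : ℤ) - N := by
      rw [Int.floor_eq_iff]
      simp only [c, mem_Ico] at hy
      push_cast at hy ⊢
      constructor
      · rw [le_div_iff₀ hT']; linarith
      · rw [div_lt_iff₀ hT']; linarith
    simp only [hf, hfl]
    push_cast
    ring
  have h3 : ∀ m : ℕ, ∑ n ∈ Finset.range m, ((n : ℝ) - N) * (φ (c (n + 1)) - φ (c n))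
      = ((m : ℝ) - N) * φ (c m) + N * φ (c 0) - ∑ n ∈ Finset.range m, φ (c (n + 1)) := by
    intro m
    induction m with
    | zero => simp
    | succ m ih =>
      rw [Finset.sum_range_succ, ih, Finset.sum_range_succ]
      push_cast
      ring
  have hc0 : φ (c 0) = 0 := (hR _ (by
    simp only [c]
    rw [add_sub_cancel_left, abs_mul, abs_of_pos hT']
    simp only [Nat.cast_zero, zero_sub, abs_neg, Nat.abs_cast]
    exact hN'.le)).1
  have hc2 : φ (c (2 * N)) = 0 := (hR _ (by
    simp only [c]
    push_cast
    rw [add_sub_cancel_left, abs_mul, abs_of_pos hT', show (2 : ℝ) * N - N = N by ring,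
      Nat.abs_cast]
    exact hN'.le)).1
  have h4 : ∑ n ∈ Finset.range (2 * N), φ (c (n + 1)) = ∑ n ∈ Finset.range (2 * N), φ (c n) := by
    have := Finset.sum_range_succ (fun n => φ (c n)) (2 * N)
    rw [Finset.sum_range_succ', hc0, hc2] at this
    linarith
  have h5 : ∑ k ∈ Finset.Ico (-(N : ℤ)) N, φ (a + k * T)
      = ∑ n ∈ Finset.range (2 * N), φ (c n) := by
    symm
    refine Finset.sum_bij (fun n _ => (n : ℤ) - N) ?_ ?_ ?_ ?_
    · intro n hn
      simp only [Finset.mem_range, Finset.mem_Ico] at hn ⊢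
      omega
    · intro n _ m _ h
      omega
    · intro k hk
      simp only [Finset.mem_range, Finset.mem_Ico] at hk ⊢
      exact ⟨(k + N).toNat, by omega, by omega⟩
    · intro n _
      simp [c]
  rw [h1, h2, h3, hc0, hc2, h4, h5]
  ring

theorem jumpProfile_hasJumpDerivative {T : ℕ} (hT : 0 < T) (x : Fin T → ℝ) :
    HasJumpDerivative T x (jumpProfile T x) := by
  have hsum : LocallyIntegrable (fun y : ℝ => ∑ i, (⌊(y - x i) / T⌋ : ℝ)) :=
    locallyIntegrable_finsetSum _ fun i _ => locallyIntegrable_floor_div (x i)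
  have hidl : LocallyIntegrable (fun y : ℝ => y) := continuous_id.locallyIntegrable
  refine ⟨hidl.sub hsum, fun φ hφ hc => ?_⟩
  have hcd : Continuous (deriv φ) := hφ.continuous_deriv (by simp)
  have hfl : ∀ i, Integrable (fun y => (⌊(y - x i) / T⌋ : ℝ) * deriv φ y) := fun i =>
    (locallyIntegrable_floor_div (x i)).integrable_smul_right_of_hasCompactSupport hcd hc.deriv
  have hid : Integrable (fun y : ℝ => y * deriv φ y) :=
    (continuous_id.mul hcd).integrable_of_hasCompactSupport hc.deriv.mul_left
  have hparts : ∫ y : ℝ, y * deriv φ y = -∫ y, φ y := by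
    have := integral_mul_deriv_eq_deriv_mul_of_integrable (u := fun y : ℝ => y) (v := φ)
      (u' := fun _ => 1) (v' := deriv φ) (fun y _ => hasDerivAt_id y)
      (fun y _ => ((hφ.differentiable (by simp)) y).hasDerivAt) hid
      (by simpa [Pi.mul_def] using hφ.continuous.integrable_of_hasCompactSupport (μ := volume) hc)
      ((continuous_id.mul hφ.continuous).integrable_of_hasCompactSupport hc.mul_left)
    simpa using this
  have hexp : (fun y => jumpProfile T x y * deriv φ y)
      = fun y => y * deriv φ y - ∑ i, (⌊(y - x i) / T⌋ : ℝ) * deriv φ y := by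
    funext y
    rw [jumpProfile, sub_mul, Finset.sum_mul]
  rw [hexp, integral_sub hid (integrable_finsetSum _ fun i _ => hfl i),
    integral_finsetSum _ fun i _ => hfl i, hparts,
    Summable.tsum_finsetSum fun i _ => (integral_floor_div_mul_deriv hT (x i) hφ hc).1]
  simp only [fun i => (integral_floor_div_mul_deriv hT (x i) hφ hc).2, Finset.sum_neg_distrib]
  ring

/-- The energy of the `T`-periodic configuration of jumps `x i + k T`, as a function of the
positions `x i`. -/
def jumpEnergy (T : ℕ) (s p : ℝ) (x : Fin T → ℝ) : ℝ≥0∞ :=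
  gagliardoEnergy T s p (jumpProfile T x)

/-- A `T`-periodic configuration of `T` (possibly overlapping) jumps per period, given by its
points in `[0, T)` in nondecreasing order. It stands for the points `pts i + k T`, `k : ℤ`,
counted with multiplicity. -/
structure Config (T : ℕ) where
  pts : Fin T → ℝ
  mem_Ico : ∀ i, pts i ∈ Ico (0 : ℝ) T
  mono : Monotone pts

namespace Config

variable {T : ℕ}

/-- `F^s_p[X] = F^s_p(u[X])`. -/
def energy (s p : ℝ) (X : Config T) : ℝ≥0∞ := jumpEnergy T s p X.pts

/-- Any two points of the periodic configuration with different indices are at distance at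
least `l`. -/
def IsRegularWith (l : ℝ) (X : Config T) : Prop :=
  ∀ (i j : Fin T) (k : ℤ), (i ≠ j ∨ k ≠ 0) → l ≤ |X.pts i - (X.pts j + k * T)|

/-- Configurations with non-overlapping jumps. -/
def IsRegular (X : Config T) : Prop := ∃ l : ℝ, 0 < l ∧ l ≤ 1 ∧ X.IsRegularWith l

/-- `X + h e_i`: the point `x_i` and its translates by multiples of `T` are moved by `h`. Only the
positions are recorded here; they need not be sorted or lie in `[0, T)`. -/
def rigidVariation (X : Config T) (i : Fin T) (h : ℝ) : Fin T → ℝ :=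
  Function.update X.pts i (X.pts i + h)

/-- The first variation with respect to every rigid variation exists and vanishes:
`∂_{x_i} F^s_p[X] = 0` for all `i`. (The energy is finite when `s p < 1`.) -/
def IsCritical (s p : ℝ) (X : Config T) : Prop :=
  ∀ i, HasDerivAt (fun h : ℝ => (jumpEnergy T s p (X.rigidVariation i h)).toReal) 0 0

/-- `Y` is obtained from `X` by displacing every point by less than `ε`, where points are
identified modulo `T` and are not labelled. -/
def IsNear (ε : ℝ) (X Y : Config T) : Prop :=
  ∃ (σ : Equiv.Perm (Fin T)) (k : Fin T → ℤ), ∀ i, |Y.pts (σ i) + k i * T - X.pts i| < ε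

def IsLocalMinimiser (s p : ℝ) (X : Config T) : Prop :=
  ∃ ε : ℝ, 0 < ε ∧ ∀ Y : Config T, X.IsNear ε Y → X.energy s p ≤ Y.energy s p

def IsGlobalMinimiser (s p : ℝ) (X : Config T) : Prop :=
  ∀ Y : Config T, X.energy s p ≤ Y.energy s p

/-- `X = Y + a` for some `a : ℝ`, as periodic configurations: the points of both, counted with
multiplicity, agree modulo `T`. -/
def IsTranslateOf (X Y : Config T) : Prop :=
  ∃ (a : ℝ) (σ : Equiv.Perm (Fin T)) (k : Fin T → ℤ),
    ∀ i, X.pts (σ i) = Y.pts i + a + k i * T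

/-- The configuration with points `0, 1, …, T - 1` in `[0, T)`, that is, with jumps at all
integers. -/
def equispaced (T : ℕ) : Config T where
  pts i := ((i : ℕ) : ℝ)
  mem_Ico i := ⟨Nat.cast_nonneg _, Nat.cast_lt.2 i.isLt⟩
  mono _ _ h := Nat.cast_le.2 h

end Config

end

/-!
Enumerate the jumps as a nondecreasing sequence `ξ` with `ξ (n + T) = ξ n + T`, and write `Δ²f` for
the second difference `f (· + 1) - 2 f + f (· - 1)` of `f = |·| ^ p`. If exactly `k` jumps lie
between `y` and `y + z`, then `u (y + z) - u y = z - k`, and summation by parts in `k` gives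
`∫_0^T f (u (y + z) - u y) dy = c(z) + ∑ k, Δ²f (z - k) * ∑ i, max (z - (ξ (i + k) - ξ i)) 0`,
with `c` not depending on `ξ`. As `Δ²f ≥ 0`, the energy is a convex function of `ξ`.

The gaps satisfy `∑ i, (ξ (i + k) - ξ i) = T k`, so by Jensen's inequality the integers minimise the
inner sum for every `k` and `z`. For `k = 1` and `0 < z < 1` the minimum is `0` and its coefficient
`Δ²f (z - 1)` is positive, so in a sequence of minimal energy no gap between neighbours is shorter
than `1`; as these gaps have mean `1`, the sequence is equispaced.

By convexity, local minimisers and regular critical points are global minimisers. Conversely, moving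
one of the integers by `h` changes the inner sum by at most a multiple of `|h|`, and only for `z` at
distance less than `|h|` from an integer, so the derivative of the energy vanishes there.
-/

noncomputable section

open Filter Topology

section Convex

theorem one_add_mul_le_of_convexOn {E : Type*} [AddCommGroup E] [Module ℝ E] {C : Set E}
    {f : E → ℝ} {x y : E} (hf : ConvexOn ℝ C f) {t : ℝ} (ht : 0 ≤ t)
    (hx : x - t • (y - x) ∈ C) (hy : y ∈ C) :
    (1 + t) * f x ≤ f (x - t • (y - x)) + t * f y := by
  have ht' : 1 + t ≠ 0 := by positivity
  have hcombo : (1 / (1 + t)) • (x - t • (y - x)) + (t / (1 + t)) • y = x := by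
    match_scalars <;> field_simp <;> ring
  have h := hf.2 hx hy (show 0 ≤ 1 / (1 + t) by positivity) (show 0 ≤ t / (1 + t) by positivity)
    (by field_simp)
  rw [hcombo, smul_eq_mul, smul_eq_mul] at h
  field_simp at h
  linarith

variable {ι : Type*} [DecidableEq ι] {C : Set (ι → ℝ)} {f : (ι → ℝ) → ℝ} {x y : ι → ℝ}

theorem sum_inv_card_smul_update_add [Fintype ι] [Nonempty ι] (x v : ι → ℝ) :
    ∑ i, (Fintype.card ι : ℝ)⁻¹ • Function.update x i (x i + Fintype.card ι * v i) = x + v := by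
  ext j
  have hcard : (Fintype.card ι : ℝ) ≠ 0 := Nat.cast_ne_zero.2 Fintype.card_ne_zero
  have hupdate : ∀ i, Function.update x i (x i + Fintype.card ι * v i) j
      = x j + if i = j then Fintype.card ι * v j else 0 := by
    intro i
    by_cases hij : i = j
    · subst hij
      simp
    · simp [Function.update_of_ne (Ne.symm hij), hij]
  simp only [Finset.sum_apply, Pi.smul_apply, smul_eq_mul, hupdate, ← Finset.mul_sum,
    Finset.sum_add_distrib, Finset.sum_ite_eq', Finset.mem_univ, if_true, Finset.sum_const,
    Finset.card_univ, nsmul_eq_mul, Pi.add_apply]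
  field_simp

theorem map_add_le_sum_update_of_convexOn [Fintype ι] [Nonempty ι] (hf : ConvexOn ℝ C f)
    {v : ι → ℝ} (hmem : ∀ i, Function.update x i (x i + Fintype.card ι * v i) ∈ C) :
    f (x + v) ≤ (Fintype.card ι : ℝ)⁻¹
      * ∑ i, f (Function.update x i (x i + Fintype.card ι * v i)) := by
  rw [← sum_inv_card_smul_update_add x v, Finset.mul_sum]
  exact hf.map_sum_le (fun _ _ => by positivity) (by simp) fun i _ => hmem i

theorem hasDerivAt_sum_update_of_partialDeriv_eq_zero [Fintype ι]
    (hd : ∀ i, HasDerivAt (fun h : ℝ => f (Function.update x i (x i + h))) 0 0) (v : ι → ℝ) :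
    HasDerivAt (fun t : ℝ => ∑ i, f (Function.update x i (x i + t * v i))) 0 0 := by
  rw [← Finset.sum_const_zero (s := (Finset.univ : Finset ι))]
  refine HasDerivAt.fun_sum fun i _ => ?_
  have hdi : HasDerivAt (fun h : ℝ => f (Function.update x i (x i + h))) 0 (0 * v i) := by
    simpa using hd i
  simpa [Function.comp_def] using hdi.comp (0 : ℝ) ((hasDerivAt_id' (0 : ℝ)).mul_const (v i))

theorem le_of_convexOn_of_partialDeriv_eq_zero [Finite ι] (hf : ConvexOn ℝ C f) (hx : C ∈ 𝓝 x)
    (hy : y ∈ C) (hd : ∀ i, HasDerivAt (fun h : ℝ => f (Function.update x i (x i + h))) 0 0) :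
    f x ≤ f y := by
  rcases isEmpty_or_nonempty ι with hι | hι
  · rw [Subsingleton.elim x y]
  cases nonempty_fintype ι
  set N : ℝ := (Fintype.card ι : ℝ)
  set v : ι → ℝ := y - x
  have hN : N ≠ 0 := Nat.cast_ne_zero.2 Fintype.card_ne_zero
  -- The mean of `f` over the moved points, which by Jensen dominates `f (x - t • v)`.
  set ψ : ℝ → ℝ := fun t => N⁻¹ * ∑ i, f (Function.update x i (x i + N * (-t • v) i)) with hψ
  have hψ0 : ψ 0 = f x := by
    simp only [hψ, neg_zero, zero_smul, Pi.zero_apply, mul_zero, add_zero, Function.update_eq_self,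
      Finset.sum_const, Finset.card_univ, nsmul_eq_mul]
    exact inv_mul_cancel_left₀ hN _
  have hψ' : HasDerivAt ψ 0 0 := by
    have hcoord : ∀ t i, N * (-t • v) i = t * -(N * v i) := fun t i => by
      simp only [Pi.smul_apply, smul_eq_mul]
      ring
    simpa only [hψ, hcoord, mul_zero] using
      (hasDerivAt_sum_update_of_partialDeriv_eq_zero hd fun i => -(N * v i)).const_mul N⁻¹
  have hmem : ∀ᶠ t in 𝓝[>] (0 : ℝ),
      (∀ i, Function.update x i (x i + N * (-t • v) i) ∈ C) ∧ x - t • v ∈ C := by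
    refine nhdsWithin_le_nhds ((eventually_all.2 fun i => ?_).and ?_)
    · have hc : Continuous fun t : ℝ => Function.update x i (x i + N * (-t • v) i) :=
        continuous_const.update i (by simp only [Pi.smul_apply, smul_eq_mul]; fun_prop)
      exact hc.continuousAt.eventually_mem (by simpa using hx)
    · have hc : Continuous fun t : ℝ => x - t • v := by fun_prop
      exact hc.continuousAt.eventually_mem (by simpa using hx)
  refine sub_nonpos.1 (ge_of_tendsto hψ'.tendsto_slope_zero_right ?_)
  filter_upwards [hmem, self_mem_nhdsWithin] with t ⟨hupdate, hline⟩ (ht : 0 < t)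
  have hjensen : f (x - t • v) ≤ ψ t := by
    rw [sub_eq_add_neg, ← neg_smul]
    exact map_add_le_sum_update_of_convexOn hf hupdate
  have hchord := one_add_mul_le_of_convexOn hf ht.le hline hy
  rw [zero_add, hψ0, smul_eq_mul, le_inv_mul_iff₀ ht]
  linarith

end Convex

section PeriodicFunctions

variable {T : ℝ}

theorem setLIntegral_Ico_comp_add_of_periodic (hT : 0 < T) {f : ℝ → ℝ≥0∞}
    (hf : Function.Periodic f T) (z : ℝ) :
    ∫⁻ y in Ico 0 T, f (y + z) = ∫⁻ y in Ico 0 T, f y := by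
  have hshift : ∫⁻ y in Ico 0 T, f (y + z) = ∫⁻ y in Ico z (z + T), f y := by
    have := (measurePreserving_add_right volume z).setLIntegral_comp_preimage_emb
      (measurableEmbedding_addRight z) f (Ico z (z + T))
    rwa [preimage_add_const_Ico, sub_self, add_sub_cancel_left] at this
  rw [hshift, setLIntegral_congr Ico_ae_eq_Ioc, setLIntegral_congr (Ico_ae_eq_Ioc (a := (0 : ℝ)))]
  have := (isAddFundamentalDomain_Ioc hT z).setLIntegral_eq (isAddFundamentalDomain_Ioc hT 0) f
    hf.map_vadd_zmultiples
  rwa [zero_add] at this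

theorem tsum_setLIntegral_indicator_Ico_add_mul (hT : 0 < T) (a b : ℝ) :
    ∑' m : ℤ, ∫⁻ y in Ico (0 : ℝ) T, (Ico (a + m * T) (b + m * T)).indicator 1 y
      = ENNReal.ofReal (b - a) := by
  rw [← Real.volume_Ico, ← inter_univ (Ico a b), ← iUnion_Ico_add_zsmul hT 0, inter_iUnion,
    measure_iUnion]
  · rw [← (Equiv.neg ℤ).tsum_eq]
    refine tsum_congr fun m => ?_
    rw [lintegral_indicator_one measurableSet_Ico, Measure.restrict_apply measurableSet_Ico,
      ← measure_preimage_add_right volume (-(m : ℝ) * T)]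
    congr 1
    ext y
    simp only [mem_preimage, mem_inter_iff, mem_Ico, zsmul_eq_mul, Equiv.neg_apply]
    push_cast
    constructor <;> rintro ⟨⟨_, _⟩, _, _⟩ <;> refine ⟨⟨?_, ?_⟩, ?_, ?_⟩ <;> linarith
  · intro i j hij
    exact (pairwise_disjoint_Ico_add_zsmul (0 : ℝ) T hij).mono inter_subset_right
      inter_subset_right
  · exact fun i => measurableSet_Ico.inter measurableSet_Ico

end PeriodicFunctions

/-- The part of the energy of `u` carried by the increments `u y - u (y + z)` of fixed length `z`,
over one period. -/
def incrementEnergy (T : ℕ) (s p : ℝ) (u : ℝ → ℝ) (z : ℝ) : ℝ≥0∞ :=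
  ∫⁻ y in Ico (0 : ℝ) T, ENNReal.ofReal (|u y - u (y + z)| ^ p / |z| ^ (1 + s * p))

section IncrementEnergy

variable {T : ℕ} {u : ℝ → ℝ}

theorem gagliardoEnergy_eq_lintegral_incrementEnergy (s p : ℝ) (hu : Measurable u) :
    gagliardoEnergy T s p u = ∫⁻ z, incrementEnergy T s p u z := by
  have hmeas : Measurable fun q : ℝ × ℝ =>
      ENNReal.ofReal (|u q.2 - u (q.2 + q.1)| ^ p / |q.1| ^ (1 + s * p)) := by fun_prop
  simp only [gagliardoEnergy, incrementEnergy]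
  rw [lintegral_lintegral_swap (f := fun z y =>
      ENNReal.ofReal (|u y - u (y + z)| ^ p / |z| ^ (1 + s * p))) hmeas.aemeasurable,
    setLIntegral_congr Ico_ae_eq_Icc.symm]
  refine lintegral_congr fun y => ?_
  rw [← lintegral_add_left_eq_self _ y]
  simp only [sub_add_cancel_left, abs_neg]

theorem incrementEnergy_neg [NeZero T] (s p : ℝ) (hu : Function.Periodic u T) (z : ℝ) :
    incrementEnergy T s p u (-z) = incrementEnergy T s p u z := by
  have hperiodic : Function.Periodic
      (fun y => ENNReal.ofReal (|u y - u (y + z)| ^ p / |z| ^ (1 + s * p))) T := by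
    intro y
    simp only [hu y, add_right_comm y (T : ℝ) z, hu (y + z)]
  simp only [incrementEnergy]
  rw [← setLIntegral_Ico_comp_add_of_periodic (Nat.cast_pos.2 (NeZero.pos T)) hperiodic (-z)]
  simp only [abs_neg, neg_add_cancel_right, abs_sub_comm]

theorem gagliardoEnergy_eq_two_mul_lintegral_Ioi [NeZero T] (s p : ℝ) (hu : Measurable u)
    (hper : Function.Periodic u T) :
    gagliardoEnergy T s p u = 2 * ∫⁻ z in Ioi 0, incrementEnergy T s p u z := by
  have hneg : ∫⁻ z in Iio 0, incrementEnergy T s p u z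
      = ∫⁻ z in Ioi 0, incrementEnergy T s p u z := by
    have := (Measure.measurePreserving_neg (volume : Measure ℝ)).setLIntegral_comp_preimage_emb
      (Homeomorph.neg ℝ).measurableEmbedding (incrementEnergy T s p u) (Iio 0)
    simpa [incrementEnergy_neg s p hper] using this.symm
  rw [gagliardoEnergy_eq_lintegral_incrementEnergy s p hu,
    ← lintegral_add_compl _ measurableSet_Ioi, compl_Ioi,
    setLIntegral_congr Iio_ae_eq_Iic.symm, hneg, two_mul]

end IncrementEnergy

theorem integrableOn_Ioi_div_rpow {g : ℝ → ℝ} {A B α : ℝ} (hα : α ∈ Ioo (0 : ℝ) 1)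
    (hg : Measurable g) (hA : ∀ z > 0, |g z| ≤ A * z) (hB : ∀ z > 0, |g z| ≤ B) :
    IntegrableOn (fun z => g z / z ^ (1 + α)) (Ioi 0) := by
  have hmeas : Measurable fun z => g z / z ^ (1 + α) := by fun_prop
  have hnorm : ∀ z : ℝ, 0 < z → ‖g z / z ^ (1 + α)‖ = |g z| / z ^ (1 + α) := fun z hz => by
    rw [norm_div, Real.norm_eq_abs, Real.norm_of_nonneg (by positivity)]
  rw [← Ioc_union_Ioi_eq_Ioi (zero_le_one (α := ℝ))]
  refine IntegrableOn.union ?_ ?_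
  · have hint : IntegrableOn (fun z : ℝ => A * z ^ (-α)) (Ioc 0 1) :=
      ((intervalIntegrable_iff_integrableOn_Ioc_of_le zero_le_one).1
        (intervalIntegral.intervalIntegrable_rpow' (by linarith [hα.2]))).const_mul _
    refine hint.mono' hmeas.aestronglyMeasurable ?_
    filter_upwards [ae_restrict_mem measurableSet_Ioc] with z hz
    rw [hnorm z hz.1, div_le_iff₀ (Real.rpow_pos_of_pos hz.1 _), mul_assoc, ← Real.rpow_add hz.1,
      show -α + (1 + α) = 1 by ring, Real.rpow_one]
    exact hA z hz.1
  · have hint : IntegrableOn (fun z : ℝ => B * z ^ (-(1 + α))) (Ioi 1) :=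
      (integrableOn_Ioi_rpow_of_lt (by linarith [hα.1]) one_pos).const_mul _
    refine hint.mono' hmeas.aestronglyMeasurable ?_
    filter_upwards [ae_restrict_mem measurableSet_Ioi] with z hz
    have hz0 : 0 < z := one_pos.trans hz
    rw [hnorm z hz0, div_le_iff₀ (Real.rpow_pos_of_pos hz0 _), mul_assoc, ← Real.rpow_add hz0,
      neg_add_cancel, Real.rpow_zero, mul_one]
    exact hB z hz0

/-- The symmetric second difference of `φ` with step one. -/
def secondDiff (φ : ℝ → ℝ) (t : ℝ) : ℝ := φ (t + 1) - 2 * φ t + φ (t - 1)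

section SecondDiff

theorem secondDiff_nonneg {φ : ℝ → ℝ} (hφ : ConvexOn ℝ univ φ) (t : ℝ) : 0 ≤ secondDiff φ t := by
  have h := hφ.2 (mem_univ (t + 1)) (mem_univ (t - 1)) (show (0 : ℝ) ≤ 1 / 2 by norm_num)
    (show (0 : ℝ) ≤ 1 / 2 by norm_num) (by norm_num)
  simp only [smul_eq_mul] at h
  rw [show 1 / 2 * (t + 1) + 1 / 2 * (t - 1) = t by ring] at h
  unfold secondDiff
  linarith

theorem sum_secondDiff_mul_max_eq (φ : ℝ → ℝ) (z : ℝ) {x : ℝ} (K : ℕ) (hx : K ≤ x) :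
    φ z + (φ (z - 1) - φ z) * x
      + ∑ k ∈ Finset.range K, secondDiff φ (z - (k + 1)) * max (x - (k + 1 : ℕ)) 0
      = φ (z - K) + (φ (z - (K + 1)) - φ (z - K)) * (x - K) := by
  induction K with
  | zero => simp
  | succ K ih =>
    have hK : ((K : ℝ) + 1) ≤ x := by exact_mod_cast hx
    rw [Finset.sum_range_succ, ← add_assoc, ih (by linarith), max_eq_left (by push_cast; linarith),
      secondDiff, show z - ((K : ℝ) + 1) + 1 = z - K by ring,
      show z - ((K : ℝ) + 1) - 1 = z - (K + 1 + 1) by ring]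
    push_cast
    ring

theorem apply_sub_natCast_eq (φ : ℝ → ℝ) (z : ℝ) {n K : ℕ} (hn : n ≤ K) :
    φ (z - n) = φ z + (φ (z - 1) - φ z) * n
      + ∑ k ∈ Finset.range K, secondDiff φ (z - (k + 1)) * max ((n : ℝ) - (k + 1 : ℕ)) 0 := by
  rw [← Finset.sum_subset (Finset.range_mono hn), sum_secondDiff_mul_max_eq φ z n le_rfl, sub_self,
    mul_zero, add_zero]
  intro k _ hk
  have : (n : ℝ) ≤ k := by exact_mod_cast not_lt.1 (Finset.mem_range.not.1 hk)
  rw [max_eq_right (by push_cast; linarith), mul_zero]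

variable {p : ℝ}

theorem convexOn_abs_rpow (hp : 1 ≤ p) : ConvexOn ℝ univ fun t : ℝ => |t| ^ p := by
  refine ⟨convex_univ, fun x _ y _ a b ha hb hab => ?_⟩
  calc |a • x + b • y| ^ p ≤ (a • |x| + b • |y|) ^ p := by
        gcongr
        exact convexOn_univ_norm.2 (mem_univ x) (mem_univ y) ha hb hab
    _ ≤ a • |x| ^ p + b • |y| ^ p :=
        (convexOn_rpow hp).2 (abs_nonneg x) (abs_nonneg y) ha hb hab

theorem secondDiff_abs_rpow_pos (hp : 1 ≤ p) {t : ℝ} (ht : |t| < 1) :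
    0 < secondDiff (fun t => |t| ^ p) t := by
  have ht' := abs_lt.1 ht
  have hconvex := (convexOn_rpow hp).2 (show 0 ≤ 1 + t by linarith) (show 0 ≤ 1 - t by linarith)
    (show (0 : ℝ) ≤ 1 / 2 by norm_num) (show (0 : ℝ) ≤ 1 / 2 by norm_num) (by norm_num)
  simp only [smul_eq_mul] at hconvex
  rw [show 1 / 2 * (1 + t) + 1 / 2 * (1 - t) = 1 by ring, Real.one_rpow] at hconvex
  have hlt := Real.rpow_lt_one (abs_nonneg t) ht (show 0 < p by linarith)
  rw [secondDiff, abs_of_pos (show 0 < t + 1 by linarith), abs_sub_comm t 1,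
    abs_of_pos (show 0 < 1 - t by linarith), add_comm t 1]
  linarith

theorem secondDiff_abs_rpow_le (hp : 0 ≤ p) {t : ℝ} (ht : |t| ≤ 1) :
    secondDiff (fun t => |t| ^ p) t ≤ 2 * 2 ^ p := by
  have ht' := abs_le.1 ht
  have hadd : |t + 1| ^ p ≤ 2 ^ p := by
    gcongr
    exact abs_le.2 ⟨by linarith, by linarith⟩
  have hsub : |t - 1| ^ p ≤ 2 ^ p := by
    gcongr
    exact abs_le.2 ⟨by linarith, by linarith⟩
  have hmid := Real.rpow_nonneg (abs_nonneg t) p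
  unfold secondDiff
  linarith

theorem abs_rpow_le_mul_abs (hp : 1 ≤ p) {t R : ℝ} (ht : |t| ≤ R) :
    |t| ^ p ≤ R ^ (p - 1) * |t| := by
  calc |t| ^ p = |t| ^ (p - 1) * |t| := by
        rw [← Real.rpow_add_one' (abs_nonneg t) (by linarith), sub_add_cancel]
    _ ≤ R ^ (p - 1) * |t| := by
        gcongr

end SecondDiff

/-- A nondecreasing enumeration of a `T`-periodic configuration with `T` points per period. -/
structure IsEnumeration (T : ℕ) (ξ : ℤ → ℝ) : Prop where
  mono : Monotone ξ
  add_period : ∀ n, ξ (n + T) = ξ n + T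

/-- The points `x i + k T` are, with multiplicity, the points `ξ n`. -/
def Enumerates (T : ℕ) (ξ : ℤ → ℝ) (x : Fin T → ℝ) : Prop :=
  ∃ (σ : Equiv.Perm (Fin T)) (k : Fin T → ℤ), ∀ i, x (σ i) = ξ (i : ℕ) + k i * T

/-- The largest `n` with `ξ n ≤ y`, for an enumeration `ξ`. Expressing it by floors makes it
directly comparable with `jumpProfile`. -/
def lastIndex (T : ℕ) (ξ : ℤ → ℝ) (y : ℝ) : ℤ :=
  ∑ i ∈ Finset.range T, ⌊(y - ξ i) / T⌋ + T - 1

/-- The number of points of the enumerated configuration in `(y, y + z]`. -/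
def jumpCount (T : ℕ) (ξ : ℤ → ℝ) (y z : ℝ) : ℤ := lastIndex T ξ (y + z) - lastIndex T ξ y

/-- The sum over one period of the excess `(z - (ξ (i + k) - ξ i))⁺` of `z` over the gap between
points with indices differing by `k`. -/
def gapSum (T : ℕ) (ξ : ℤ → ℝ) (z : ℝ) (k : ℕ) : ℝ :=
  ∑ i ∈ Finset.range T, max (z - (ξ (i + k) - ξ i)) 0

/-- The integral of `φ (z - jumpCount T ξ y z)` over one period in `y`, in terms of the gaps.
There are at most `⌈z⌉₊ + T` points in an interval of length `z`, so the sum contains all nonzero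
terms. -/
def incrementIntegral (T : ℕ) (φ : ℝ → ℝ) (ξ : ℤ → ℝ) (z : ℝ) : ℝ :=
  T * φ z + (φ (z - 1) - φ z) * (T * z)
    + ∑ k ∈ Finset.range (⌈z⌉₊ + T), secondDiff φ (z - (k + 1)) * gapSum T ξ z (k + 1)

section Counting

theorem exists_eq_add_mul_period (T : ℕ) [NeZero T] (n : ℤ) :
    ∃ (i : Fin T) (m : ℤ), n = (i : ℕ) + m * T := by
  obtain ⟨⟨m, i⟩, rfl⟩ := (Int.divModEquiv T).symm.surjective n
  exact ⟨i, m, by simp [add_comm]⟩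

variable {T : ℕ} {ξ : ℤ → ℝ}

theorem IsEnumeration.add_mul_period (h : IsEnumeration T ξ) (n m : ℤ) :
    ξ (n + m * T) = ξ n + m * T := by
  let f : AddConstMap ℤ ℝ (T : ℤ) (T : ℝ) := ⟨ξ, h.add_period⟩
  have hf : ξ (n + m • (T : ℤ)) = ξ n + m • (T : ℝ) := AddConstMapClass.map_add_zsmul f n m
  simpa using hf

variable [NeZero T]

theorem Enumerates.jumpProfile_eq {x : Fin T → ℝ} (hx : Enumerates T ξ x) :
    ∃ c : ℝ, ∀ y, jumpProfile T x y = y - lastIndex T ξ y + c := by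
  have hT : (T : ℝ) ≠ 0 := NeZero.ne _
  obtain ⟨σ, k, hk⟩ := hx
  refine ⟨∑ i, (k i : ℝ) + (T - 1), fun y => ?_⟩
  have hfloor : ∀ i : Fin T, ⌊(y - x (σ i)) / T⌋ = ⌊(y - ξ (i : ℕ)) / T⌋ - k i := by
    intro i
    rw [← Int.floor_sub_intCast, hk]
    congr 1
    field_simp
    ring
  rw [jumpProfile, lastIndex, ← Equiv.sum_comp σ]
  simp only [hfloor]
  push_cast
  rw [Finset.sum_sub_distrib, ← Fin.sum_univ_eq_sum_range (fun i => (⌊(y - ξ i) / T⌋ : ℝ))]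
  ring

theorem Enumerates.jumpProfile_sub {x : Fin T → ℝ} (hx : Enumerates T ξ x) (y z : ℝ) :
    jumpProfile T x y - jumpProfile T x (y + z) = -(z - jumpCount T ξ y z) := by
  obtain ⟨c, hc⟩ := hx.jumpProfile_eq
  rw [hc, hc, jumpCount]
  push_cast
  ring

theorem abs_sub_jumpCount_le (T : ℕ) [NeZero T] (ξ : ℤ → ℝ) (y z : ℝ) :
    |z - jumpCount T ξ y z| ≤ T := by
  have hT : (T : ℝ) ≠ 0 := NeZero.ne _
  have hfract : z - jumpCount T ξ y z
      = ∑ i ∈ Finset.range T, (Int.fract ((y + z - ξ i) / T) - Int.fract ((y - ξ i) / T)) := by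
    unfold jumpCount lastIndex Int.fract
    push_cast
    simp only [Finset.sum_sub_distrib, ← Finset.sum_div, Finset.sum_add_distrib,
      Finset.sum_const, Finset.card_range, nsmul_eq_mul]
    field_simp
    ring
  rw [hfract]
  refine (Finset.abs_sum_le_sum_abs _ _).trans ((Finset.sum_le_card_nsmul _ _ 1 ?_).trans_eq ?_)
  · intro i _
    rw [abs_le]
    constructor <;> linarith [Int.fract_nonneg ((y + z - ξ i) / T),
      Int.fract_lt_one ((y + z - ξ i) / T), Int.fract_nonneg ((y - ξ i) / T),
      Int.fract_lt_one ((y - ξ i) / T)]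
  · simp

namespace IsEnumeration

theorem sum_floor_shift (h : IsEnumeration T ξ) (y : ℝ) (n : ℤ) :
    ∑ i ∈ Finset.range T, ⌊(y - ξ (n + i)) / T⌋
      = ∑ i ∈ Finset.range T, ⌊(y - ξ i) / T⌋ - n := by
  have hT : (T : ℝ) ≠ 0 := NeZero.ne _
  have hsucc : ∀ n : ℤ, ∑ i ∈ Finset.range T, ⌊(y - ξ (n + 1 + i)) / T⌋
      = ∑ i ∈ Finset.range T, ⌊(y - ξ (n + i)) / T⌋ - 1 := by
    intro n
    have hlast : ⌊(y - ξ (n + T)) / T⌋ = ⌊(y - ξ n) / T⌋ - 1 := by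
      rw [← Int.floor_sub_one, h.add_period]
      congr 1
      field_simp
      ring
    have htele := Finset.sum_range_succ (fun i : ℕ => ⌊(y - ξ (n + i)) / T⌋) T
    rw [Finset.sum_range_succ', hlast] at htele
    simp only [Nat.cast_add, Nat.cast_one, Nat.cast_zero, add_zero, ← add_assoc] at htele
    simp only [add_right_comm n 1]
    linarith
  induction n using Int.induction_on with
  | zero => simp
  | succ m ih => rw [hsucc, ih]; ring
  | pred m ih =>
    have := hsucc (-(m : ℤ) - 1)
    rw [sub_add_cancel, ih] at this
    linarith

theorem le_lastIndex_iff (h : IsEnumeration T ξ) {y : ℝ} {n : ℤ} :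
    n ≤ lastIndex T ξ y ↔ ξ n ≤ y := by
  have hT : (0 : ℝ) < T := Nat.cast_pos.2 (NeZero.pos T)
  constructor
  · intro hn
    by_contra! hy
    have hneg : ∑ i ∈ Finset.range T, ⌊(y - ξ (n + i)) / T⌋ ≤ ∑ i ∈ Finset.range T, (-1 : ℤ) := by
      refine Finset.sum_le_sum fun i _ => Int.le_of_lt_add_one (Int.floor_lt.2 ?_)
      rw [neg_add_cancel, Int.cast_zero]
      exact div_neg_of_neg_of_pos (by linarith [h.mono (show n ≤ n + i by omega)]) hT
    rw [h.sum_floor_shift, Finset.sum_const, Finset.card_range, nsmul_eq_mul] at hneg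
    unfold lastIndex at hn
    linarith
  · intro hy
    have hnonneg : 0 ≤ ∑ i ∈ Finset.range T, ⌊(y - ξ (n - T + 1 + i)) / T⌋ := by
      refine Finset.sum_nonneg fun i hi => Int.floor_nonneg.2 (div_nonneg ?_ hT.le)
      have hi' := Finset.mem_range.1 hi
      linarith [h.mono (show n - T + 1 + i ≤ n by omega)]
    rw [h.sum_floor_shift] at hnonneg
    unfold lastIndex
    linarith

theorem lastIndex_mono (h : IsEnumeration T ξ) : Monotone (lastIndex T ξ) :=
  fun _ _ hab => h.le_lastIndex_iff.2 ((h.le_lastIndex_iff.1 le_rfl).trans hab)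

theorem jumpCount_nonneg (h : IsEnumeration T ξ) (y : ℝ) {z : ℝ} (hz : 0 ≤ z) :
    0 ≤ jumpCount T ξ y z :=
  sub_nonneg.2 (h.lastIndex_mono (le_add_of_nonneg_right hz))

theorem measurable_jumpCount (h : IsEnumeration T ξ) (z : ℝ) :
    Measurable fun y => (jumpCount T ξ y z : ℝ) := by
  have hlast : Measurable fun y => (lastIndex T ξ y : ℝ) :=
    (Int.cast_mono.comp h.lastIndex_mono).measurable
  simp only [jumpCount, Int.cast_sub]
  exact (hlast.comp (measurable_id.add_const z)).sub hlast

theorem tsum_indicator_Ico (h : IsEnumeration T ξ) (z : ℝ) (k : ℕ) (y : ℝ) :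
    ∑' n : ℤ, (Ico (ξ (n + k) - z) (ξ n)).indicator (1 : ℝ → ℝ≥0∞) y
      = ENNReal.ofReal (max (jumpCount T ξ y z - k : ℝ) 0) := by
  set J := Finset.Ioc (lastIndex T ξ y) (lastIndex T ξ (y + z) - k)
  have hmem : ∀ n : ℤ, y ∈ Ico (ξ (n + k) - z) (ξ n) ↔ n ∈ J := by
    intro n
    rw [mem_Ico, Finset.mem_Ioc, le_sub_iff_add_le, h.le_lastIndex_iff, ← not_le (a := n),
      h.le_lastIndex_iff, not_le, sub_le_iff_le_add, and_comm]
  have hcard : ((J.card : ℕ) : ℝ) = max (jumpCount T ξ y z - k : ℝ) 0 := by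
    rw [Int.card_Ioc, ← Int.cast_natCast, Int.ofNat_toNat, jumpCount]
    push_cast
    rw [sub_right_comm]
  rw [tsum_eq_sum fun n hn => indicator_of_notMem (fun hy => hn ((hmem n).1 hy)) _,
    Finset.sum_congr rfl fun n hn => indicator_of_mem ((hmem n).2 hn) _, ← hcard]
  simp

theorem setLIntegral_max_jumpCount_sub (h : IsEnumeration T ξ) (z : ℝ) (k : ℕ) :
    ∫⁻ y in Ico (0 : ℝ) T, ENNReal.ofReal (max (jumpCount T ξ y z - k : ℝ) 0)
      = ∑ i ∈ Finset.range T, ENNReal.ofReal (z - (ξ (i + k) - ξ i)) := by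
  simp only [← h.tsum_indicator_Ico]
  rw [lintegral_tsum fun n => (measurable_one.indicator measurableSet_Ico).aemeasurable,
    ← (Int.divModEquiv T).symm.tsum_eq, ENNReal.tsum_prod', ENNReal.tsum_comm, tsum_fintype,
    ← Fin.sum_univ_eq_sum_range (fun i => ENNReal.ofReal (z - (ξ (i + k) - ξ i)))]
  refine Finset.sum_congr rfl fun i _ => ?_
  rw [show z - (ξ ((i : ℕ) + k) - ξ (i : ℕ)) = ξ (i : ℕ) - (ξ ((i : ℕ) + k) - z) by ring,
    ← tsum_setLIntegral_indicator_Ico_add_mul (Nat.cast_pos.2 (NeZero.pos T))]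
  refine tsum_congr fun m => ?_
  have hn : (Int.divModEquiv T).symm (m, i) = (i : ℕ) + m * T := by simp [add_comm]
  rw [hn, add_right_comm, h.add_mul_period, h.add_mul_period, add_sub_right_comm]

theorem integrableOn_max_jumpCount_sub (h : IsEnumeration T ξ) (z : ℝ) (k : ℕ) :
    IntegrableOn (fun y => max (jumpCount T ξ y z - k : ℝ) 0) (Ico (0 : ℝ) T) := by
  refine ⟨(((h.measurable_jumpCount z).sub_const _).max measurable_const).aestronglyMeasurable, ?_⟩
  rw [hasFiniteIntegral_iff_ofReal (ae_of_all _ fun y => le_max_right _ (0 : ℝ)),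
    h.setLIntegral_max_jumpCount_sub]
  exact ENNReal.sum_lt_top.2 fun _ _ => ENNReal.ofReal_lt_top

theorem integral_max_jumpCount_sub (h : IsEnumeration T ξ) (z : ℝ) (k : ℕ) :
    ∫ y in Ico (0 : ℝ) T, max (jumpCount T ξ y z - k : ℝ) 0 = gapSum T ξ z k := by
  rw [integral_eq_lintegral_of_nonneg_ae (ae_of_all _ fun y => le_max_right _ (0 : ℝ))
    (h.integrableOn_max_jumpCount_sub z k).1, h.setLIntegral_max_jumpCount_sub,
    ENNReal.toReal_sum fun _ _ => ENNReal.ofReal_ne_top]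
  rfl

theorem integrableOn_jumpCount (h : IsEnumeration T ξ) {z : ℝ} (hz : 0 ≤ z) :
    IntegrableOn (fun y => (jumpCount T ξ y z : ℝ)) (Ico (0 : ℝ) T) := by
  simpa [h.jumpCount_nonneg _ hz] using h.integrableOn_max_jumpCount_sub z 0

theorem integral_jumpCount (h : IsEnumeration T ξ) {z : ℝ} (hz : 0 ≤ z) :
    ∫ y in Ico (0 : ℝ) T, (jumpCount T ξ y z : ℝ) = T * z := by
  simpa [gapSum, h.jumpCount_nonneg _ hz, hz] using h.integral_max_jumpCount_sub z 0

theorem apply_sub_jumpCount_eq (h : IsEnumeration T ξ) (φ : ℝ → ℝ) (y : ℝ) {z : ℝ} (hz : 0 ≤ z) :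
    φ (z - jumpCount T ξ y z) = φ z + (φ (z - 1) - φ z) * jumpCount T ξ y z
      + ∑ k ∈ Finset.range (⌈z⌉₊ + T), secondDiff φ (z - (k + 1))
        * max (jumpCount T ξ y z - (k + 1 : ℕ) : ℝ) 0 := by
  have hle := (abs_le.1 (abs_sub_jumpCount_le T ξ y z)).1
  obtain ⟨n, hn⟩ := Int.eq_ofNat_of_zero_le (h.jumpCount_nonneg y hz)
  rw [hn, Int.cast_natCast] at hle ⊢
  have hnK : n ≤ ⌈z⌉₊ + T := by
    have : (n : ℝ) ≤ (⌈z⌉₊ + T : ℕ) := by push_cast; linarith [Nat.le_ceil z]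
    exact_mod_cast this
  exact apply_sub_natCast_eq φ z hnK

theorem integrableOn_and_integral_apply_sub_jumpCount (h : IsEnumeration T ξ) (φ : ℝ → ℝ) {z : ℝ}
    (hz : 0 ≤ z) :
    IntegrableOn (fun y => φ (z - jumpCount T ξ y z)) (Ico (0 : ℝ) T) ∧
    ∫ y in Ico (0 : ℝ) T, φ (z - jumpCount T ξ y z) = incrementIntegral T φ ξ z := by
  simp only [h.apply_sub_jumpCount_eq φ _ hz]
  have hconst : IntegrableOn (fun _ : ℝ => φ z) (Ico (0 : ℝ) T) := integrableOn_const (by simp)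
  have hlin := (h.integrableOn_jumpCount hz).const_mul (φ (z - 1) - φ z)
  have hterm := fun k : ℕ =>
    (h.integrableOn_max_jumpCount_sub z (k + 1)).const_mul (secondDiff φ (z - (k + 1)))
  have hsum := integrable_finsetSum (Finset.range (⌈z⌉₊ + T)) fun k _ => hterm k
  refine ⟨(hconst.add hlin).add hsum, ?_⟩
  rw [integral_add (by exact hconst.add hlin) hsum, integral_add hconst hlin,
    integral_finsetSum _ fun k _ => hterm k]
  simp only [integral_const_mul, h.integral_max_jumpCount_sub, h.integral_jumpCount hz]
  simp [incrementIntegral]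

theorem integrableOn_apply_sub_jumpCount (h : IsEnumeration T ξ) (φ : ℝ → ℝ) {z : ℝ} (hz : 0 ≤ z) :
    IntegrableOn (fun y => φ (z - jumpCount T ξ y z)) (Ico (0 : ℝ) T) :=
  (h.integrableOn_and_integral_apply_sub_jumpCount φ hz).1

theorem integral_apply_sub_jumpCount (h : IsEnumeration T ξ) (φ : ℝ → ℝ) {z : ℝ} (hz : 0 ≤ z) :
    ∫ y in Ico (0 : ℝ) T, φ (z - jumpCount T ξ y z) = incrementIntegral T φ ξ z :=
  (h.integrableOn_and_integral_apply_sub_jumpCount φ hz).2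

variable {φ : ℝ → ℝ}

theorem incrementIntegral_nonneg (h : IsEnumeration T ξ) (hφ : ∀ t, 0 ≤ φ t) {z : ℝ} (hz : 0 ≤ z) :
    0 ≤ incrementIntegral T φ ξ z := by
  rw [← h.integral_apply_sub_jumpCount φ hz]
  exact integral_nonneg fun y => hφ _

theorem incrementIntegral_le (h : IsEnumeration T ξ) {B : ℝ} (hφ : ∀ t : ℝ, |t| ≤ T → φ t ≤ B)
    {z : ℝ} (hz : 0 ≤ z) : incrementIntegral T φ ξ z ≤ T * B := by
  rw [← h.integral_apply_sub_jumpCount φ hz]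
  calc ∫ y in Ico (0 : ℝ) T, φ (z - jumpCount T ξ y z)
      ≤ ∫ _ in Ico (0 : ℝ) T, B :=
        setIntegral_mono (h.integrableOn_apply_sub_jumpCount φ hz) (integrableOn_const (by simp))
          fun y => hφ _ (abs_sub_jumpCount_le T ξ y z)
    _ = T * B := by simp

theorem incrementIntegral_le_mul (h : IsEnumeration T ξ) {A : ℝ} (hA : 0 ≤ A)
    (hφ : ∀ t : ℝ, |t| ≤ T → φ t ≤ A * |t|) {z : ℝ} (hz : 0 ≤ z) :
    incrementIntegral T φ ξ z ≤ 2 * T * A * z := by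
  have hconst : IntegrableOn (fun _ : ℝ => z) (Ico (0 : ℝ) T) := integrableOn_const (by simp)
  have hcount := h.integrableOn_jumpCount hz
  rw [← h.integral_apply_sub_jumpCount φ hz]
  calc ∫ y in Ico (0 : ℝ) T, φ (z - jumpCount T ξ y z)
      ≤ ∫ y in Ico (0 : ℝ) T, A * (z + jumpCount T ξ y z) := by
        refine setIntegral_mono (h.integrableOn_apply_sub_jumpCount φ hz)
          ((hconst.add hcount).const_mul A) fun y => (hφ _ (abs_sub_jumpCount_le T ξ y z)).trans ?_
        have hN : (0 : ℝ) ≤ jumpCount T ξ y z := Int.cast_nonneg (h.jumpCount_nonneg y hz)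
        gcongr
        exact abs_le.2 ⟨by linarith, by linarith⟩
    _ = 2 * T * A * z := by
        rw [integral_const_mul, integral_add hconst hcount, h.integral_jumpCount hz]
        simp only [integral_const, smul_eq_mul, measureReal_restrict_apply_univ,
          Real.volume_real_Ico_of_le (Nat.cast_nonneg T)]
        ring

end IsEnumeration

theorem measurable_incrementIntegral (T : ℕ) {φ : ℝ → ℝ} (hφ : Measurable φ) (ξ : ℤ → ℝ) :
    Measurable (incrementIntegral T φ ξ) := by
  have hsum : Measurable fun q : ℕ × ℝ => ∑ k ∈ Finset.range (q.1 + T),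
      secondDiff φ (q.2 - (k + 1)) * gapSum T ξ q.2 (k + 1) := by
    refine measurable_from_prod_countable_right fun n => ?_
    simp only [secondDiff, gapSum]
    fun_prop
  have hceil : Measurable fun z : ℝ => (⌈z⌉₊, z) := Nat.measurable_ceil.prodMk measurable_id
  exact (by fun_prop : Measurable fun z => T * φ z + (φ (z - 1) - φ z) * (T * z)).add
    (hsum.comp hceil)

end Counting

section Equispaced

variable {T : ℕ}

theorem isEnumeration_intCast_add (T : ℕ) (c : ℝ) : IsEnumeration T fun n : ℤ => (n : ℝ) + c :=
  ⟨fun m n h => by simpa using h, fun n => by push_cast; ring⟩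

theorem isEnumeration_intCast (T : ℕ) : IsEnumeration T (Int.cast : ℤ → ℝ) := by
  simpa using isEnumeration_intCast_add T 0

theorem gapSum_intCast (T : ℕ) (z : ℝ) (k : ℕ) :
    gapSum T (Int.cast : ℤ → ℝ) z k = T * max (z - k) 0 := by
  simp [gapSum]

theorem incrementIntegral_add_const (T : ℕ) (φ : ℝ → ℝ) (ξ : ℤ → ℝ) (c z : ℝ) :
    incrementIntegral T φ (fun n => ξ n + c) z = incrementIntegral T φ ξ z := by
  simp [incrementIntegral, gapSum]

theorem convexOn_gapSum (T : ℕ) (z : ℝ) (k : ℕ) :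
    ConvexOn ℝ univ fun ξ : ℤ → ℝ => gapSum T ξ z k := by
  refine ⟨convex_univ, fun ξ _ η _ a b ha hb hab => ?_⟩
  simp only [gapSum, Finset.smul_sum, ← Finset.sum_add_distrib]
  gcongr with i
  refine max_le ?_ (by positivity)
  calc z - ((a • ξ + b • η) (i + k) - (a • ξ + b • η) i)
      = a * (z - (ξ (i + k) - ξ i)) + b * (z - (η (i + k) - η i)) := by
        simp only [Pi.add_apply, Pi.smul_apply, smul_eq_mul]
        linear_combination (-z) * hab
    _ ≤ a • max (z - (ξ (i + k) - ξ i)) 0 + b • max (z - (η (i + k) - η i)) 0 := by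
        simp only [smul_eq_mul]
        gcongr <;> exact le_max_left _ _

theorem convexOn_incrementIntegral (T : ℕ) {φ : ℝ → ℝ} (hφ : ConvexOn ℝ univ φ) (z : ℝ) :
    ConvexOn ℝ univ fun ξ : ℤ → ℝ => incrementIntegral T φ ξ z := by
  refine (convexOn_const _ convex_univ).add ⟨convex_univ, fun ξ _ η _ a b ha hb hab => ?_⟩
  simp only [Finset.smul_sum, ← Finset.sum_add_distrib]
  gcongr with k
  have hgap := (convexOn_gapSum T z (k + 1)).2 (mem_univ ξ) (mem_univ η) ha hb hab
  have hmul := mul_le_mul_of_nonneg_left hgap (secondDiff_nonneg hφ (z - (k + 1)))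
  simp only [smul_eq_mul] at hmul ⊢
  linarith

end Equispaced

/-- The difference between the gap sums of `ξ` and of the equispaced configuration. -/
def gapExcess (T : ℕ) (ξ : ℤ → ℝ) (z : ℝ) (k : ℕ) : ℝ := gapSum T ξ z k - T * max (z - k) 0

/-- All gaps of `ξ` differ by at most `δ` from those of the equispaced configuration. -/
def IsNearEquispaced (δ : ℝ) (ξ : ℤ → ℝ) : Prop := ∀ (n : ℤ) (k : ℕ), |ξ (n + k) - ξ n - k| ≤ δ

section GapExcess

variable {T : ℕ} {ξ : ℤ → ℝ} {φ : ℝ → ℝ} {δ z : ℝ}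

theorem incrementIntegral_eq_add (T : ℕ) (φ : ℝ → ℝ) (ξ : ℤ → ℝ) (z : ℝ) :
    incrementIntegral T φ ξ z = incrementIntegral T φ Int.cast z
      + ∑ k ∈ Finset.range (⌈z⌉₊ + T), secondDiff φ (z - (k + 1)) * gapExcess T ξ z (k + 1) := by
  simp only [incrementIntegral, gapExcess, gapSum_intCast, mul_sub, Finset.sum_sub_distrib]
  ring

theorem IsNearEquispaced.nonneg (hξ : IsNearEquispaced δ ξ) : 0 ≤ δ :=
  (abs_nonneg _).trans (hξ 0 0)

theorem IsNearEquispaced.gapExcess_le (hξ : IsNearEquispaced δ ξ) (T : ℕ) (z : ℝ) (k : ℕ) :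
    gapExcess T ξ z k ≤ T * δ := by
  have hδ := hξ.nonneg
  rw [gapExcess, sub_le_iff_le_add']
  calc gapSum T ξ z k ≤ ∑ _i ∈ Finset.range T, (max (z - k) 0 + δ) := by
        refine Finset.sum_le_sum fun i _ => max_le ?_ (by positivity)
        linarith [(abs_le.1 (hξ i k)).1, le_max_left (z - k) 0]
    _ = T * max (z - k) 0 + T * δ := by simp

namespace IsEnumeration

theorem sum_gap (h : IsEnumeration T ξ) (k : ℕ) :
    ∑ i ∈ Finset.range T, (ξ (i + k) - ξ i) = T * k := by
  induction k with
  | zero => simp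
  | succ k ih =>
    have htele := Finset.sum_range_sub (fun i : ℕ => ξ (i + k)) T
    rw [add_comm (T : ℤ), h.add_period] at htele
    calc ∑ i ∈ Finset.range T, (ξ (i + (k + 1 : ℕ)) - ξ i)
        = ∑ i ∈ Finset.range T, ((ξ ((i + 1 : ℕ) + k) - ξ (i + k)) + (ξ (i + k) - ξ i)) := by
          push_cast
          simp only [sub_add_sub_cancel, add_assoc, add_comm (1 : ℤ)]
      _ = T * (k + 1 : ℕ) := by
          rw [Finset.sum_add_distrib, ih, htele]
          push_cast
          simp only [zero_add]
          ring

theorem sum_sub_gap (h : IsEnumeration T ξ) (z : ℝ) (k : ℕ) :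
    ∑ i ∈ Finset.range T, (z - (ξ (i + k) - ξ i)) = T * (z - k) := by
  rw [Finset.sum_sub_distrib, h.sum_gap]
  simp [mul_sub]

theorem gapExcess_nonneg (h : IsEnumeration T ξ) (z : ℝ) (k : ℕ) : 0 ≤ gapExcess T ξ z k := by
  rw [gapExcess, sub_nonneg, mul_max_of_nonneg _ _ (Nat.cast_nonneg T), mul_zero,
    ← h.sum_sub_gap]
  exact max_le (Finset.sum_le_sum fun _ _ => le_max_left _ _)
    (Finset.sum_nonneg fun _ _ => le_max_right _ _)

theorem gapExcess_eq_zero_of_near (h : IsEnumeration T ξ) (hξ : IsNearEquispaced δ ξ) {k : ℕ}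
    (hz : δ ≤ |z - k|) : gapExcess T ξ z k = 0 := by
  have hδ := hξ.nonneg
  rw [gapExcess, sub_eq_zero]
  rcases le_abs.1 hz with hz | hz
  · rw [max_eq_left (by linarith), ← h.sum_sub_gap]
    exact Finset.sum_congr rfl fun i _ => max_eq_left (by linarith [(abs_le.1 (hξ i k)).2])
  · rw [max_eq_right (by linarith), mul_zero]
    exact Finset.sum_eq_zero fun i _ => max_eq_right (by linarith [(abs_le.1 (hξ i k)).1])

theorem incrementIntegral_intCast_le (h : IsEnumeration T ξ) (hφ : ConvexOn ℝ univ φ) (z : ℝ) :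
    incrementIntegral T φ Int.cast z ≤ incrementIntegral T φ ξ z := by
  rw [incrementIntegral_eq_add T φ ξ]
  exact le_add_of_nonneg_right (Finset.sum_nonneg fun k _ =>
    mul_nonneg (secondDiff_nonneg hφ _) (mod_cast h.gapExcess_nonneg z (k + 1)))

theorem incrementIntegral_intCast_lt (h : IsEnumeration T ξ) (hφ : ConvexOn ℝ univ φ)
    (hz : z ≤ 1) (hφz : 0 < secondDiff φ (z - 1)) {i : ℕ} (hi : i < T)
    (hgap : ξ (i + 1) - ξ i < z) :
    incrementIntegral T φ Int.cast z < incrementIntegral T φ ξ z := by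
  have hpos : 0 < gapExcess T ξ z 1 := by
    rw [gapExcess, max_eq_right (by simpa using hz), mul_zero, sub_zero]
    exact (lt_max_of_lt_left (by simpa using hgap)).trans_le
      (Finset.single_le_sum (f := fun i : ℕ => max (z - (ξ (i + (1 : ℕ)) - ξ i)) 0)
        (fun _ _ => le_max_right _ _) (Finset.mem_range.2 hi))
  rw [incrementIntegral_eq_add T φ ξ]
  refine lt_add_of_pos_right _ (Finset.sum_pos' (fun k _ =>
    mul_nonneg (secondDiff_nonneg hφ _) (h.gapExcess_nonneg z (k + 1)))
    ⟨0, Finset.mem_range.2 (by omega), ?_⟩)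
  simpa using mul_pos hφz hpos

theorem incrementIntegral_eq_of_near (h : IsEnumeration T ξ) (φ : ℝ → ℝ)
    (hξ : IsNearEquispaced δ ξ) (hz : ∀ k : ℕ, δ ≤ |z - (k + 1 : ℕ)|) :
    incrementIntegral T φ ξ z = incrementIntegral T φ Int.cast z := by
  simp [incrementIntegral_eq_add T φ ξ, fun k => h.gapExcess_eq_zero_of_near hξ (hz k)]

theorem incrementIntegral_le_of_near (h : IsEnumeration T ξ) {B : ℝ}
    (hB : 0 ≤ B) (hφ : ∀ t, |t| ≤ 1 → secondDiff φ t ≤ B) (hξ : IsNearEquispaced δ ξ)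
    (hδ : δ ≤ 1 / 2) (z : ℝ) :
    incrementIntegral T φ ξ z ≤ incrementIntegral T φ Int.cast z + B * (T * δ) := by
  by_cases! hz : ∀ k : ℕ, δ ≤ |z - (k + 1 : ℕ)|
  · rw [h.incrementIntegral_eq_of_near φ hξ hz]
    exact le_add_of_nonneg_right (mul_nonneg hB (mul_nonneg (Nat.cast_nonneg T) hξ.nonneg))
  obtain ⟨k, hk⟩ := hz
  have habs := abs_le.1 (hk.le.trans hδ)
  push_cast at habs
  have hmem : k ∈ Finset.range (⌈z⌉₊ + T) :=
    Finset.mem_range.2 ((Nat.lt_ceil.2 (by linarith)).trans_le (Nat.le_add_right _ _))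
  have hfar : ∀ l ≠ k, gapExcess T ξ z (l + 1) = 0 := by
    intro l hl
    refine h.gapExcess_eq_zero_of_near hξ ?_
    have hlk : (1 : ℝ) ≤ |((l + 1 : ℕ) : ℝ) - (k + 1 : ℕ)| := by
      exact_mod_cast Int.one_le_abs (show ((l + 1 : ℕ) : ℤ) - (k + 1 : ℕ) ≠ 0 by omega)
    linarith [abs_sub_le ((l + 1 : ℕ) : ℝ) z (k + 1 : ℕ), abs_sub_comm ((l + 1 : ℕ) : ℝ) z]
  have hexcess := h.gapExcess_nonneg z (k + 1)
  rw [incrementIntegral_eq_add T φ ξ,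
    Finset.sum_eq_single_of_mem k hmem fun l _ hl => by rw [hfar l hl, mul_zero]]
  gcongr
  · exact hφ _ (abs_le.2 ⟨by linarith, by linarith⟩)
  · exact hξ.gapExcess_le T z (k + 1)

end IsEnumeration

end GapExcess

/-- The energy of the configuration enumerated by `ξ`, expressed by its gaps. -/
def gapEnergy (T : ℕ) (s p : ℝ) (ξ : ℤ → ℝ) : ℝ :=
  2 * ∫ z in Ioi 0, incrementIntegral T (fun t => |t| ^ p) ξ z / z ^ (1 + s * p)

section GapEnergy

theorem measurable_jumpProfile (T : ℕ) (x : Fin T → ℝ) : Measurable (jumpProfile T x) :=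
  measurable_id.sub (Finset.measurable_fun_sum _ fun i _ => measurable_from_top.comp
    (Int.measurable_floor.comp ((measurable_id.sub_const (x i)).div_const (T : ℝ))))

theorem gapEnergy_add_const (T : ℕ) (s p : ℝ) (ξ : ℤ → ℝ) (c : ℝ) :
    gapEnergy T s p (fun n => ξ n + c) = gapEnergy T s p ξ := by
  simp only [gapEnergy, incrementIntegral_add_const]

theorem convex_setOf_isEnumeration (T : ℕ) : Convex ℝ {ξ | IsEnumeration T ξ} := by
  intro ξ hξ η hη a b ha hb hab
  refine ⟨fun m n hmn => ?_, fun n => ?_⟩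
  · simp only [Pi.add_apply, Pi.smul_apply, smul_eq_mul]
    gcongr
    exacts [hξ.mono hmn, hη.mono hmn]
  · simp only [Pi.add_apply, Pi.smul_apply, smul_eq_mul, hξ.add_period, hη.add_period]
    linear_combination (T : ℝ) * hab

variable {T : ℕ} {s p : ℝ} {ξ : ℤ → ℝ}

theorem IsEnumeration.incrementIntegral_div_intCast_le (h : IsEnumeration T ξ) (hp : 1 ≤ p) (s : ℝ)
    {z : ℝ} (hz : 0 < z) :
    incrementIntegral T (fun t => |t| ^ p) Int.cast z / z ^ (1 + s * p)
      ≤ incrementIntegral T (fun t => |t| ^ p) ξ z / z ^ (1 + s * p) := by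
  gcongr
  exact h.incrementIntegral_intCast_le (convexOn_abs_rpow hp) z

theorem IsEnumeration.abs_incrementIntegral_sub_div_le_of_near {δ z : ℝ} (h : IsEnumeration T ξ)
    (hp : 1 ≤ p) (s : ℝ) (hξ : IsNearEquispaced δ ξ) (hδ : δ ≤ 1 / 2) (hz : 0 < z) :
    |incrementIntegral T (fun t => |t| ^ p) ξ z / z ^ (1 + s * p)
        - incrementIntegral T (fun t => |t| ^ p) Int.cast z / z ^ (1 + s * p)|
      ≤ δ * (Ioi (1 / 2 : ℝ)).indicator (fun z => 2 * 2 ^ p * T * z ^ (-(1 + s * p))) z := by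
  have hle := h.incrementIntegral_div_intCast_le hp s hz
  rw [abs_of_nonneg (sub_nonneg.2 hle)]
  by_cases hz2 : z ∈ Ioi (1 / 2 : ℝ)
  · have hnear := h.incrementIntegral_le_of_near (B := 2 * 2 ^ p) (by positivity)
      (fun t ht => secondDiff_abs_rpow_le (zero_le_one.trans hp) ht) hξ hδ z
    rw [indicator_of_mem hz2, Real.rpow_neg hz.le, ← sub_div, ← div_eq_mul_inv, ← mul_div_assoc]
    gcongr
    linarith
  · rw [indicator_of_notMem hz2, mul_zero, h.incrementIntegral_eq_of_near _ hξ, sub_self]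
    intro k
    rw [mem_Ioi, not_lt] at hz2
    push_cast
    rw [abs_sub_comm]
    exact le_abs.2 (Or.inl (by linarith [Nat.cast_nonneg (α := ℝ) k]))

theorem exists_pos_forall_le_abs_sub_natCast {z : ℝ} (hz : z ∉ range (Int.cast : ℤ → ℝ)) :
    ∃ δ > 0, ∀ k : ℕ, δ ≤ |z - k| :=
  ⟨|z - round z|, abs_pos.2 (sub_ne_zero.2 fun h => hz ⟨_, h.symm⟩), fun k => round_le z k⟩

variable [NeZero T]

namespace IsEnumeration

theorem integrableOn_incrementIntegral_div (h : IsEnumeration T ξ) (hp : 1 ≤ p)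
    (hsp : s * p ∈ Ioo (0 : ℝ) 1) :
    IntegrableOn (fun z => incrementIntegral T (fun t => |t| ^ p) ξ z / z ^ (1 + s * p))
      (Ioi 0) := by
  have hbound : ∀ t : ℝ, |t| ≤ T → |t| ^ p ≤ T ^ (p - 1) * |t| := fun t =>
    abs_rpow_le_mul_abs hp
  have habs : ∀ z > 0, |incrementIntegral T (fun t => |t| ^ p) ξ z|
      = incrementIntegral T (fun t => |t| ^ p) ξ z := fun z hz =>
    abs_of_nonneg (h.incrementIntegral_nonneg (fun t => by positivity) (le_of_lt hz))
  refine integrableOn_Ioi_div_rpow hsp (measurable_incrementIntegral T (by fun_prop) ξ)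
    (A := 2 * T * (T : ℝ) ^ (p - 1)) (B := T * (T : ℝ) ^ p) ?_ ?_ <;> intro z hz <;> rw [habs z hz]
  · exact h.incrementIntegral_le_mul (by positivity) hbound hz.le
  · refine h.incrementIntegral_le (fun t ht => ?_) hz.le
    gcongr

theorem incrementEnergy_jumpProfile (h : IsEnumeration T ξ) {x : Fin T → ℝ}
    (hx : Enumerates T ξ x) (s p : ℝ) {z : ℝ} (hz : 0 < z) :
    incrementEnergy T s p (jumpProfile T x) z
      = ENNReal.ofReal (incrementIntegral T (fun t => |t| ^ p) ξ z / z ^ (1 + s * p)) := by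
  have hint := h.integrableOn_apply_sub_jumpCount (fun t => |t| ^ p) hz.le
  rw [← h.integral_apply_sub_jumpCount _ hz.le, ← integral_div,
    ofReal_integral_eq_lintegral_ofReal (hint.div_const _) (ae_of_all _ fun y => by positivity)]
  simp only [incrementEnergy, hx.jumpProfile_sub, abs_neg, abs_of_pos hz]

theorem jumpEnergy_eq_ofReal_gapEnergy (h : IsEnumeration T ξ) (hp : 1 ≤ p)
    (hsp : s * p ∈ Ioo (0 : ℝ) 1) {x : Fin T → ℝ} (hx : Enumerates T ξ x) :
    jumpEnergy T s p x = ENNReal.ofReal (gapEnergy T s p ξ) := by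
  rw [jumpEnergy, gagliardoEnergy_eq_two_mul_lintegral_Ioi s p (measurable_jumpProfile T x)
      (jumpProfile_periodic (NeZero.pos T) x),
    setLIntegral_congr_fun measurableSet_Ioi fun z hz => h.incrementEnergy_jumpProfile hx s p hz,
    gapEnergy, ENNReal.ofReal_mul zero_le_two, ENNReal.ofReal_ofNat,
    ofReal_integral_eq_lintegral_ofReal (h.integrableOn_incrementIntegral_div hp hsp)]
  filter_upwards [ae_restrict_mem measurableSet_Ioi] with z hz
  have hz' : 0 < z := hz
  exact div_nonneg (h.incrementIntegral_nonneg (fun t => by positivity) hz'.le) (by positivity)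

theorem gapEnergy_nonneg (h : IsEnumeration T ξ) (s p : ℝ) : 0 ≤ gapEnergy T s p ξ := by
  refine mul_nonneg zero_le_two (setIntegral_nonneg measurableSet_Ioi fun z hz => ?_)
  have hz' : 0 < z := hz
  exact div_nonneg (h.incrementIntegral_nonneg (fun t => by positivity) hz'.le) (by positivity)

theorem toReal_jumpEnergy (h : IsEnumeration T ξ) (hp : 1 ≤ p) (hsp : s * p ∈ Ioo (0 : ℝ) 1)
    {x : Fin T → ℝ} (hx : Enumerates T ξ x) :
    (jumpEnergy T s p x).toReal = gapEnergy T s p ξ := by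
  rw [h.jumpEnergy_eq_ofReal_gapEnergy hp hsp hx, ENNReal.toReal_ofReal (h.gapEnergy_nonneg s p)]

theorem gapEnergy_intCast_le (h : IsEnumeration T ξ) (hp : 1 ≤ p) (hsp : s * p ∈ Ioo (0 : ℝ) 1) :
    gapEnergy T s p Int.cast ≤ gapEnergy T s p ξ := by
  unfold gapEnergy
  gcongr 2 * ?_
  exact setIntegral_mono_on ((isEnumeration_intCast T).integrableOn_incrementIntegral_div hp hsp)
    (h.integrableOn_incrementIntegral_div hp hsp) measurableSet_Ioi
    fun z hz => h.incrementIntegral_div_intCast_le hp s hz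

theorem ae_incrementIntegral_eq_of_gapEnergy_le (h : IsEnumeration T ξ) (hp : 1 ≤ p)
    (hsp : s * p ∈ Ioo (0 : ℝ) 1) (hle : gapEnergy T s p ξ ≤ gapEnergy T s p Int.cast) :
    ∀ᵐ z : ℝ, 0 < z → incrementIntegral T (fun t => |t| ^ p) Int.cast z
      = incrementIntegral T (fun t => |t| ^ p) ξ z := by
  have heq := mul_left_cancel₀ two_ne_zero ((h.gapEnergy_intCast_le hp hsp).antisymm hle)
  rw [integral_eq_iff_of_ae_le
    ((isEnumeration_intCast T).integrableOn_incrementIntegral_div hp hsp)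
    (h.integrableOn_incrementIntegral_div hp hsp)
    ((ae_restrict_mem measurableSet_Ioi).mono fun z hz =>
      h.incrementIntegral_div_intCast_le hp s hz),
    EventuallyEq, ae_restrict_iff' measurableSet_Ioi] at heq
  filter_upwards [heq] with z hz hz0
  exact (div_left_inj' (Real.rpow_pos_of_pos hz0 _).ne').1 (hz hz0)

theorem one_le_gap_of_gapEnergy_le (h : IsEnumeration T ξ) (hp : 1 ≤ p)
    (hsp : s * p ∈ Ioo (0 : ℝ) 1) (hle : gapEnergy T s p ξ ≤ gapEnergy T s p Int.cast)
    {i : ℕ} (hi : i < T) : 1 ≤ ξ (i + 1) - ξ i := by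
  have hnull : ∀ᵐ z : ℝ, z ∉ Ioo (ξ (i + 1) - ξ i) 1 := by
    filter_upwards [h.ae_incrementIntegral_eq_of_gapEnergy_le hp hsp hle] with z heq hz
    have hz0 : 0 < z := (sub_nonneg.2 (h.mono (by omega))).trans_lt hz.1
    have hdiff := secondDiff_abs_rpow_pos hp
      (abs_lt.2 ⟨by linarith, by linarith [hz.2]⟩ : |z - 1| < 1)
    exact (h.incrementIntegral_intCast_lt (convexOn_abs_rpow hp) hz.2.le hdiff hi hz.1).ne (heq hz0)
  rw [← measure_eq_zero_iff_ae_notMem, Real.volume_Ioo, ENNReal.ofReal_eq_zero] at hnull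
  linarith

/- The sequence `ξ n - n` is nondecreasing and `T`-periodic. -/
theorem eq_intCast_add_of_one_le_gap (h : IsEnumeration T ξ)
    (hgap : ∀ i < T, 1 ≤ ξ ((i : ℕ) + 1) - ξ i) (n : ℤ) : ξ n = n + ξ 0 := by
  have hmono : Monotone fun n : ℤ => ξ n - n := by
    refine monotone_int_of_le_succ fun n => ?_
    obtain ⟨i, m, rfl⟩ := exists_eq_add_mul_period T n
    rw [add_right_comm, h.add_mul_period, h.add_mul_period]
    push_cast
    linarith [hgap i i.isLt]
  obtain ⟨i, m, rfl⟩ := exists_eq_add_mul_period T n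
  have hlow := hmono (show (0 : ℤ) ≤ (i : ℕ) by omega)
  have hupp := hmono (show ((i : ℕ) : ℤ) ≤ 0 + T by omega)
  simp only [h.add_period] at hlow hupp
  rw [h.add_mul_period]
  push_cast at hlow hupp ⊢
  linarith

theorem eq_intCast_add_of_gapEnergy_le (h : IsEnumeration T ξ) (hp : 1 ≤ p)
    (hsp : s * p ∈ Ioo (0 : ℝ) 1) (hle : gapEnergy T s p ξ ≤ gapEnergy T s p Int.cast) (n : ℤ) :
    ξ n = n + ξ 0 :=
  h.eq_intCast_add_of_one_le_gap (fun _ hi => h.one_le_gap_of_gapEnergy_le hp hsp hle hi) n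

end IsEnumeration

theorem convexOn_gapEnergy (hp : 1 ≤ p) (hsp : s * p ∈ Ioo (0 : ℝ) 1) :
    ConvexOn ℝ {ξ | IsEnumeration T ξ} (gapEnergy T s p) := by
  have hconvex := convex_setOf_isEnumeration T
  refine ⟨hconvex, fun ξ hξ η hη a b ha hb hab => ?_⟩
  have hintξ := (hξ.integrableOn_incrementIntegral_div hp hsp).const_mul a
  have hintη := (hη.integrableOn_incrementIntegral_div hp hsp).const_mul b
  have hle := setIntegral_mono_on
    ((hconvex hξ hη ha hb hab).integrableOn_incrementIntegral_div hp hsp)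
    (hintξ.add hintη) measurableSet_Ioi fun z hz => by
      have hz' : 0 < z := hz
      have hcomb := (convexOn_incrementIntegral T (convexOn_abs_rpow hp) z).2
        (mem_univ ξ) (mem_univ η) ha hb hab
      simp only [Pi.add_apply, ← mul_div_assoc, ← add_div]
      gcongr
      exact hcomb
  rw [integral_add' hintξ hintη, integral_const_mul, integral_const_mul] at hle
  simp only [gapEnergy, smul_eq_mul]
  linarith

theorem tendsto_integral_incrementIntegral_sub_div (hp : 1 ≤ p) (hsp : s * p ∈ Ioo (0 : ℝ) 1)
    {ξ : ℝ → ℤ → ℝ} (hξ : ∀ᶠ h in 𝓝 0, IsEnumeration T (ξ h))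
    (hnear : ∀ᶠ h in 𝓝 0, IsNearEquispaced |h| (ξ h)) :
    Tendsto (fun h => ∫ z in Ioi 0, h⁻¹ *
        (incrementIntegral T (fun t => |t| ^ p) (ξ h) z / z ^ (1 + s * p)
          - incrementIntegral T (fun t => |t| ^ p) Int.cast z / z ^ (1 + s * p)))
      (𝓝[≠] 0) (𝓝 0) := by
  have hsmall : ∀ δ > 0, ∀ᶠ h in 𝓝[≠] (0 : ℝ), |h| ≤ δ := fun δ hδ =>
    nhdsWithin_le_nhds ((continuous_abs.tendsto' 0 0 abs_zero).eventually_le_const hδ)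
  replace hξ := hξ.filter_mono (nhdsWithin_le_nhds (s := {0}ᶜ))
  replace hnear := hnear.filter_mono (nhdsWithin_le_nhds (s := {0}ᶜ))
  convert tendsto_integral_filter_of_dominated_convergence (f := fun _ => (0 : ℝ))
    (l := 𝓝[≠] (0 : ℝ))
    ((Ioi (1 / 2 : ℝ)).indicator fun z => 2 * 2 ^ p * T * z ^ (-(1 + s * p))) ?_ ?_ ?_ ?_ using 2
  · exact (integral_zero _ _).symm
  · filter_upwards [hξ] with h hh
    exact ((hh.integrableOn_incrementIntegral_div hp hsp).sub
      ((isEnumeration_intCast T).integrableOn_incrementIntegral_div hp hsp)).1.const_mul _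
  · filter_upwards [hξ, hnear, hsmall (1 / 2) (by norm_num), self_mem_nhdsWithin]
      with h hh hhnear hhsmall hh0
    filter_upwards [ae_restrict_mem measurableSet_Ioi] with z hz
    rw [norm_mul, norm_inv, Real.norm_eq_abs, Real.norm_eq_abs, inv_mul_le_iff₀ (abs_pos.2 hh0)]
    exact hh.abs_incrementIntegral_sub_div_le_of_near hp s hhnear hhsmall hz
  · rw [integrable_indicator_iff measurableSet_Ioi]
    have hlt : -(1 + s * p) < -1 := by linarith [hsp.1]
    exact IntegrableOn.mono_measure ((integrableOn_Ioi_rpow_of_lt hlt one_half_pos).const_mul _)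
      Measure.restrict_le_self
  · have hnotint : ∀ᵐ z : ℝ, z ∉ range (Int.cast : ℤ → ℝ) := (countable_range _).ae_notMem volume
    filter_upwards [ae_restrict_of_ae hnotint] with z hz
    obtain ⟨δ, hδ, hδz⟩ := exists_pos_forall_le_abs_sub_natCast hz
    refine tendsto_const_nhds.congr' ?_
    filter_upwards [hξ, hnear, hsmall δ hδ] with h hh hhnear hhsmall
    rw [hh.incrementIntegral_eq_of_near _ hhnear fun k => hhsmall.trans (hδz (k + 1)), sub_self,
      mul_zero]

theorem hasDerivAt_gapEnergy_zero (hp : 1 ≤ p) (hsp : s * p ∈ Ioo (0 : ℝ) 1) {ξ : ℝ → ℤ → ℝ}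
    (hξ : ∀ᶠ h in 𝓝 0, IsEnumeration T (ξ h))
    (hnear : ∀ᶠ h in 𝓝 0, IsNearEquispaced |h| (ξ h)) :
    HasDerivAt (fun h => gapEnergy T s p (ξ h)) 0 0 := by
  have hzero : gapEnergy T s p (ξ 0) = gapEnergy T s p Int.cast := by
    have hnear0 : IsNearEquispaced 0 (ξ 0) := by simpa using hnear.self_of_nhds
    have heq : incrementIntegral T (fun t => |t| ^ p) (ξ 0)
        = incrementIntegral T (fun t => |t| ^ p) Int.cast := funext fun z =>
      hξ.self_of_nhds.incrementIntegral_eq_of_near _ hnear0 fun _ => abs_nonneg _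
    rw [gapEnergy, heq, gapEnergy]
  have hlim := (tendsto_integral_incrementIntegral_sub_div hp hsp hξ hnear).const_mul 2
  rw [mul_zero] at hlim
  rw [hasDerivAt_iff_tendsto_slope_zero]
  refine hlim.congr' ?_
  filter_upwards [hξ.filter_mono nhdsWithin_le_nhds] with h hh
  rw [zero_add, hzero, integral_const_mul,
    integral_sub (hh.integrableOn_incrementIntegral_div hp hsp)
      ((isEnumeration_intCast T).integrableOn_incrementIntegral_div hp hsp),
    gapEnergy, gapEnergy, smul_eq_mul]
  ring

end GapEnergy

/-- The extension of a tuple to all integer indices by `ξ (n + T) = ξ n + T`. -/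
def periodicExtension {T : ℕ} [NeZero T] (x : Fin T → ℝ) (n : ℤ) : ℝ :=
  x (Int.divModEquiv T n).2 + (Int.divModEquiv T n).1 * T

/-- The tuples whose periodic extension is nondecreasing. -/
def orderedTuples (T : ℕ) : Set (Fin T → ℝ) := {x | Monotone x ∧ ∀ i j, x i ≤ x j + T}

theorem convex_orderedTuples (T : ℕ) : Convex ℝ (orderedTuples T) := by
  intro x hx y hy a b ha hb hab
  refine ⟨fun i j hij => ?_, fun i j => ?_⟩
  · simp only [Pi.add_apply, Pi.smul_apply, smul_eq_mul]
    gcongr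
    · exact hx.1 hij
    · exact hy.1 hij
  · simp only [Pi.add_apply, Pi.smul_apply, smul_eq_mul]
    have hxij := mul_le_mul_of_nonneg_left (hx.2 i j) ha
    have hyij := mul_le_mul_of_nonneg_left (hy.2 i j) hb
    linear_combination hxij + hyij + T * hab

section periodicExtension

variable {T : ℕ} [NeZero T]

theorem periodicExtension_add_mul (x : Fin T → ℝ) (i : Fin T) (m : ℤ) :
    periodicExtension x ((i : ℕ) + m * T) = x i + m * T := by
  have hdivMod : ((i : ℕ) : ℤ) + m * T = (Int.divModEquiv T).symm (m, i) := by
    simp [Int.divModEquiv, add_comm]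
  rw [periodicExtension, hdivMod, Equiv.apply_symm_apply]

theorem periodicExtension_coe (x : Fin T → ℝ) (i : Fin T) :
    periodicExtension x (i : ℕ) = x i := by
  simpa using periodicExtension_add_mul x i 0

theorem periodicExtension_add_period (x : Fin T → ℝ) (n : ℤ) :
    periodicExtension x (n + T) = periodicExtension x n + T := by
  obtain ⟨i, m, rfl⟩ := exists_eq_add_mul_period T n
  rw [show ((i : ℕ) : ℤ) + m * T + T = (i : ℕ) + (m + 1) * T by ring, periodicExtension_add_mul,
    periodicExtension_add_mul]
  push_cast
  ring

theorem periodicExtension_combo (x y : Fin T → ℝ) {a b : ℝ} (hab : a + b = 1) :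
    periodicExtension (a • x + b • y) = a • periodicExtension x + b • periodicExtension y := by
  funext n
  simp only [periodicExtension, Pi.add_apply, Pi.smul_apply, smul_eq_mul]
  linear_combination -(((Int.divModEquiv T n).1 : ℝ) * T) * hab

theorem enumerates_periodicExtension (x : Fin T → ℝ) : Enumerates T (periodicExtension x) x :=
  ⟨1, 0, fun i => by simp [periodicExtension_coe]⟩

theorem monotone_periodicExtension {x : Fin T → ℝ} (hx : x ∈ orderedTuples T) :
    Monotone (periodicExtension x) := by
  intro a b hab
  obtain ⟨i, m, rfl⟩ := exists_eq_add_mul_period T a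
  obtain ⟨j, l, rfl⟩ := exists_eq_add_mul_period T b
  rw [periodicExtension_add_mul, periodicExtension_add_mul]
  have hml : m ≤ l := by
    by_contra! hlm
    have : (l + 1) * (T : ℤ) ≤ m * T := by gcongr; omega
    linarith [show ((j : ℕ) : ℤ) < T by omega]
  rcases hml.eq_or_lt with rfl | hlt
  · have hij : i ≤ j := by
      rw [Fin.le_def]
      omega
    linarith [hx.1 hij]
  · have hperiods : ((m : ℝ) + 1) * T ≤ l * T := by
      gcongr
      exact_mod_cast hlt
    linarith [hx.2 i j]

theorem isEnumeration_periodicExtension {x : Fin T → ℝ} (hx : x ∈ orderedTuples T) :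
    IsEnumeration T (periodicExtension x) :=
  ⟨monotone_periodicExtension hx, periodicExtension_add_period x⟩

theorem exists_isEnumeration_enumerates (x : Fin T → ℝ) :
    ∃ ξ : ℤ → ℝ, IsEnumeration T ξ ∧ Enumerates T ξ x := by
  have hT : (0 : ℝ) < T := Nat.cast_pos'.2 (Nat.pos_of_neZero T)
  set w : Fin T → ℝ := fun i => toIcoMod hT 0 (x i)
  have hw : ∀ i, w i ∈ Ico (0 : ℝ) T := fun i => by simpa using toIcoMod_mem_Ico hT 0 (x i)
  have hord : w ∘ Tuple.sort w ∈ orderedTuples T :=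
    ⟨Tuple.monotone_sort w, fun i j =>
      (hw _).2.le.trans (le_add_of_nonneg_left (hw (Tuple.sort w j)).1)⟩
  refine ⟨_, isEnumeration_periodicExtension hord, Tuple.sort w,
    fun i => toIcoDiv hT 0 (x (Tuple.sort w i)), fun i => ?_⟩
  rw [periodicExtension_coe, ← zsmul_eq_mul]
  exact (toIcoMod_add_toIcoDiv_zsmul hT 0 _).symm

variable {s p : ℝ}

theorem jumpEnergy_ne_top (hp : 1 ≤ p) (hsp : s * p ∈ Ioo (0 : ℝ) 1) (x : Fin T → ℝ) :
    jumpEnergy T s p x ≠ ⊤ := by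
  obtain ⟨ξ, h, hx⟩ := exists_isEnumeration_enumerates x
  rw [h.jumpEnergy_eq_ofReal_gapEnergy hp hsp hx]
  exact ENNReal.ofReal_ne_top

theorem toReal_jumpEnergy_eq_gapEnergy (hp : 1 ≤ p) (hsp : s * p ∈ Ioo (0 : ℝ) 1) {x : Fin T → ℝ}
    (hx : IsEnumeration T (periodicExtension x)) :
    (jumpEnergy T s p x).toReal = gapEnergy T s p (periodicExtension x) :=
  hx.toReal_jumpEnergy hp hsp (enumerates_periodicExtension x)

theorem convexOn_jumpEnergy (hp : 1 ≤ p) (hsp : s * p ∈ Ioo (0 : ℝ) 1) :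
    ConvexOn ℝ (orderedTuples T) fun x => (jumpEnergy T s p x).toReal := by
  refine ⟨convex_orderedTuples T, fun x hx y hy a b ha hb hab => ?_⟩
  have hx' := isEnumeration_periodicExtension hx
  have hy' := isEnumeration_periodicExtension hy
  have hxy' := isEnumeration_periodicExtension (convex_orderedTuples T hx hy ha hb hab)
  simp only [toReal_jumpEnergy_eq_gapEnergy hp hsp hx', toReal_jumpEnergy_eq_gapEnergy hp hsp hy',
    toReal_jumpEnergy_eq_gapEnergy hp hsp hxy', periodicExtension_combo x y hab]
  exact (convexOn_gapEnergy hp hsp).2 hx' hy' ha hb hab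

theorem periodicExtension_update_eq_or {x : Fin T → ℝ} {c : ℝ} (hx : ∀ i, x i = (i : ℕ) + c)
    (j : Fin T) (h : ℝ) (n : ℤ) :
    periodicExtension (Function.update x j (x j + h)) n = n + c ∨
      periodicExtension (Function.update x j (x j + h)) n = n + c + h := by
  obtain ⟨i, m, rfl⟩ := exists_eq_add_mul_period T n
  rw [periodicExtension_add_mul]
  push_cast
  rcases eq_or_ne i j with rfl | hij
  · right
    rw [Function.update_self, hx]
    ring
  · left
    rw [Function.update_of_ne hij, hx]
    ring

theorem isNearEquispaced_periodicExtension_update {x : Fin T → ℝ} {c : ℝ}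
    (hx : ∀ i, x i = (i : ℕ) + c) (j : Fin T) (h : ℝ) :
    IsNearEquispaced |h| (periodicExtension (Function.update x j (x j + h))) := by
  intro n k
  rw [abs_le]
  have hle := le_abs_self h
  have hge := neg_abs_le h
  rcases periodicExtension_update_eq_or hx j h n with hn | hn <;>
    rcases periodicExtension_update_eq_or hx j h (n + k) with hnk | hnk <;>
    rw [hn, hnk] <;> push_cast <;> constructor <;> linarith

theorem isEnumeration_periodicExtension_update {x : Fin T → ℝ} {c : ℝ}
    (hx : ∀ i, x i = (i : ℕ) + c) (j : Fin T) {h : ℝ} (hh : |h| ≤ 1) :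
    IsEnumeration T (periodicExtension (Function.update x j (x j + h))) := by
  refine ⟨monotone_int_of_le_succ fun n => ?_, periodicExtension_add_period _⟩
  have hgap := (abs_le.1 (isNearEquispaced_periodicExtension_update hx j h n 1)).1
  push_cast at hgap
  linarith

theorem hasDerivAt_jumpEnergy_update (hp : 1 ≤ p) (hsp : s * p ∈ Ioo (0 : ℝ) 1) {x : Fin T → ℝ}
    {c : ℝ} (hx : ∀ i, x i = (i : ℕ) + c) (j : Fin T) :
    HasDerivAt (fun h => (jumpEnergy T s p (Function.update x j (x j + h))).toReal) 0 0 := by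
  have henum : ∀ᶠ h in 𝓝 (0 : ℝ),
      IsEnumeration T (periodicExtension (Function.update x j (x j + h))) :=
    ((continuous_abs.tendsto' 0 0 abs_zero).eventually_le_const one_pos).mono fun h hh =>
      isEnumeration_periodicExtension_update hx j hh
  refine (hasDerivAt_gapEnergy_zero hp hsp henum (.of_forall fun h =>
    isNearEquispaced_periodicExtension_update hx j h)).congr_of_eventuallyEq ?_
  filter_upwards [henum] with h hh
  exact toReal_jumpEnergy_eq_gapEnergy hp hsp hh

end periodicExtension

namespace Config

variable {T : ℕ}

theorem pts_mem_orderedTuples (X : Config T) : X.pts ∈ orderedTuples T :=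
  ⟨X.mono, fun i j => by linarith [(X.mem_Ico i).2, (X.mem_Ico j).1]⟩

theorem exists_isNear_pts_eq (X Y : Config T) {ε : ℝ} (hε : 0 < ε) :
    ∃ t : ℝ, 0 < t ∧ t ≤ 1 ∧ ∃ Z : Config T,
      Z.pts = (1 - t) • X.pts + t • Y.pts ∧ X.IsNear ε Z := by
  have hT : (0 : ℝ) < T + 1 := by positivity
  obtain ⟨t, ht, htT⟩ : ∃ t ∈ Ioc (0 : ℝ) 1, t * (T + 1) ≤ ε :=
    ⟨min 1 (ε / (T + 1)), ⟨lt_min one_pos (div_pos hε hT), min_le_left _ _⟩,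
      (le_div_iff₀ hT).1 (min_le_right _ _)⟩
  have ht' : 0 ≤ 1 - t := sub_nonneg.2 ht.2
  have hdist : ∀ i, |Y.pts i - X.pts i| < T + 1 := fun i => by
    rw [abs_lt]
    constructor <;> linarith [(X.mem_Ico i).1, (X.mem_Ico i).2, (Y.mem_Ico i).1, (Y.mem_Ico i).2]
  refine ⟨t, ht.1, ht.2,
    ⟨(1 - t) • X.pts + t • Y.pts,
      fun i => convex_Ico 0 (T : ℝ) (X.mem_Ico i) (Y.mem_Ico i) ht' ht.1.le (sub_add_cancel 1 t),
      (convex_orderedTuples T X.pts_mem_orderedTuples Y.pts_mem_orderedTuples ht' ht.1.le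
        (sub_add_cancel 1 t)).1⟩, rfl, 1, 0, fun i => ?_⟩
  calc |((1 - t) • X.pts + t • Y.pts) i + ((0 : ℤ) : ℝ) * T - X.pts i|
      = t * |Y.pts i - X.pts i| := by
        rw [← abs_of_pos ht.1, ← abs_mul, abs_of_pos ht.1]
        congr 1
        simp only [Pi.add_apply, Pi.smul_apply, smul_eq_mul, Int.cast_zero]
        ring
    _ < t * (T + 1) := mul_lt_mul_of_pos_left (hdist i) ht.1
    _ ≤ ε := htT

theorem isTranslateOf_of_pts_eq {X : Config T} {c : ℝ} (hX : ∀ i, X.pts i = (i : ℕ) + c) :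
    X.IsTranslateOf (equispaced T) :=
  ⟨c, 1, 0, fun i => by simp [hX, equispaced]⟩

theorem IsTranslateOf.exists_enumerates {X : Config T} (hX : X.IsTranslateOf (equispaced T)) :
    ∃ a : ℝ, Enumerates T (fun n : ℤ => (n : ℝ) + a) X.pts := by
  obtain ⟨a, σ, k, h⟩ := hX
  exact ⟨a, σ, k, fun i => by rw [h]; simp [equispaced]⟩

theorem isRegular_of_pts_eq {X : Config T} {c : ℝ} (hX : ∀ i, X.pts i = (i : ℕ) + c) :
    X.IsRegular := by
  refine ⟨1, one_pos, le_rfl, fun i j k hijk => ?_⟩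
  have hdiff : X.pts i - (X.pts j + k * T) = (((i : ℕ) - (j : ℕ) - k * T : ℤ) : ℝ) := by
    rw [hX, hX]
    push_cast
    ring
  rw [hdiff, ← Int.cast_abs, ← Int.cast_one, Int.cast_le]
  refine Int.one_le_abs fun hzero => ?_
  have hij : ((i : ℕ) : ℤ) - (j : ℕ) = 0 :=
    Int.eq_zero_of_abs_lt_dvd (m := T) ⟨k, by linarith⟩ (by rw [abs_lt]; omega)
  have hkT : k * (T : ℤ) = 0 := by linarith
  rcases hijk with hne | hk
  · exact hne (Fin.ext (by omega))
  · exact hk ((mul_eq_zero.1 hkT).resolve_right (by omega))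

theorem IsRegular.pts_lt {X : Config T} (hX : X.IsRegular) {i j : Fin T} (hij : i < j) :
    X.pts i < X.pts j := by
  obtain ⟨l, hl, -, hreg⟩ := hX
  refine (X.mono hij.le).lt_of_ne fun heq => ?_
  have hle := hreg i j 0 (Or.inl hij.ne)
  rw [heq, Int.cast_zero, zero_mul, add_zero, sub_self, abs_zero] at hle
  exact hle.not_gt hl

theorem IsRegular.orderedTuples_mem_nhds {X : Config T} (hX : X.IsRegular) :
    orderedTuples T ∈ 𝓝 X.pts := by
  have hmono : ∀ᶠ y : Fin T → ℝ in 𝓝 X.pts, ∀ i j, i < j → y i < y j :=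
    eventually_all.2 fun i => eventually_all.2 fun j => eventually_imp_distrib_left.2 fun hij =>
      (isOpen_lt (continuous_apply i) (continuous_apply j)).mem_nhds (hX.pts_lt hij)
  have hperiod : ∀ᶠ y : Fin T → ℝ in 𝓝 X.pts, ∀ i j, y i < y j + T :=
    eventually_all.2 fun i => eventually_all.2 fun j =>
      (isOpen_lt (continuous_apply i) (by fun_prop)).mem_nhds
        ((X.mem_Ico i).2.trans_le (le_add_of_nonneg_left (X.mem_Ico j).1))
  filter_upwards [hmono, hperiod] with y hymono hyperiod
  exact ⟨fun i j hij => hij.eq_or_lt.elim (fun h => h ▸ le_rfl) fun h => (hymono i j h).le,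
    fun i j => (hyperiod i j).le⟩

section Energy

variable [NeZero T] {s p : ℝ}

theorem energy_le_energy_iff (hp : 1 ≤ p) (hsp : s * p ∈ Ioo (0 : ℝ) 1) (X Y : Config T) :
    X.energy s p ≤ Y.energy s p ↔ (X.energy s p).toReal ≤ (Y.energy s p).toReal :=
  (ENNReal.toReal_le_toReal (jumpEnergy_ne_top hp hsp _) (jumpEnergy_ne_top hp hsp _)).symm

theorem toReal_energy_eq_gapEnergy (hp : 1 ≤ p) (hsp : s * p ∈ Ioo (0 : ℝ) 1) (X : Config T) :
    (X.energy s p).toReal = gapEnergy T s p (periodicExtension X.pts) :=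
  toReal_jumpEnergy_eq_gapEnergy hp hsp (isEnumeration_periodicExtension X.pts_mem_orderedTuples)

theorem IsTranslateOf.toReal_energy_eq_gapEnergy_intCast (hp : 1 ≤ p)
    (hsp : s * p ∈ Ioo (0 : ℝ) 1) {X : Config T} (hX : X.IsTranslateOf (equispaced T)) :
    (X.energy s p).toReal = gapEnergy T s p Int.cast := by
  obtain ⟨a, ha⟩ := hX.exists_enumerates
  rw [energy, (isEnumeration_intCast_add T a).toReal_jumpEnergy hp hsp ha, gapEnergy_add_const]

theorem IsTranslateOf.isGlobalMinimiser (hp : 1 ≤ p) (hsp : s * p ∈ Ioo (0 : ℝ) 1) {X : Config T}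
    (hX : X.IsTranslateOf (equispaced T)) : X.IsGlobalMinimiser s p := by
  intro Y
  rw [energy_le_energy_iff hp hsp, hX.toReal_energy_eq_gapEnergy_intCast hp hsp,
    toReal_energy_eq_gapEnergy hp hsp]
  exact (isEnumeration_periodicExtension Y.pts_mem_orderedTuples).gapEnergy_intCast_le hp hsp

theorem IsGlobalMinimiser.exists_pts_eq (hp : 1 ≤ p) (hsp : s * p ∈ Ioo (0 : ℝ) 1) {X : Config T}
    (hX : X.IsGlobalMinimiser s p) : ∃ c : ℝ, ∀ i, X.pts i = (i : ℕ) + c := by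
  have hequi : (equispaced T).IsTranslateOf (equispaced T) :=
    isTranslateOf_of_pts_eq fun _ => (add_zero _).symm
  have hle := hX (equispaced T)
  rw [energy_le_energy_iff hp hsp, hequi.toReal_energy_eq_gapEnergy_intCast hp hsp,
    toReal_energy_eq_gapEnergy hp hsp] at hle
  refine ⟨periodicExtension X.pts 0, fun i => ?_⟩
  rw [← periodicExtension_coe X.pts i, (isEnumeration_periodicExtension
    X.pts_mem_orderedTuples).eq_intCast_add_of_gapEnergy_le hp hsp hle, Int.cast_natCast]

theorem isGlobalMinimiser_iff_isTranslateOf (hp : 1 ≤ p) (hsp : s * p ∈ Ioo (0 : ℝ) 1)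
    (X : Config T) : X.IsGlobalMinimiser s p ↔ X.IsTranslateOf (equispaced T) :=
  ⟨fun hX => (hX.exists_pts_eq hp hsp).elim fun _ hc => isTranslateOf_of_pts_eq hc,
    fun hX => hX.isGlobalMinimiser hp hsp⟩

theorem IsTranslateOf.isRegular_and_isCritical (hp : 1 ≤ p) (hsp : s * p ∈ Ioo (0 : ℝ) 1)
    {X : Config T} (hX : X.IsTranslateOf (equispaced T)) : X.IsRegular ∧ X.IsCritical s p := by
  obtain ⟨c, hc⟩ := (hX.isGlobalMinimiser hp hsp).exists_pts_eq hp hsp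
  exact ⟨isRegular_of_pts_eq hc, hasDerivAt_jumpEnergy_update hp hsp hc⟩

theorem IsCritical.isGlobalMinimiser (hp : 1 ≤ p) (hsp : s * p ∈ Ioo (0 : ℝ) 1) {X : Config T}
    (hcrit : X.IsCritical s p) (hreg : X.IsRegular) : X.IsGlobalMinimiser s p := fun Y =>
  (energy_le_energy_iff hp hsp X Y).2 <|
    le_of_convexOn_of_partialDeriv_eq_zero (convexOn_jumpEnergy hp hsp) hreg.orderedTuples_mem_nhds
      Y.pts_mem_orderedTuples hcrit

theorem IsLocalMinimiser.isGlobalMinimiser (hp : 1 ≤ p) (hsp : s * p ∈ Ioo (0 : ℝ) 1)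
    {X : Config T} (hX : X.IsLocalMinimiser s p) : X.IsGlobalMinimiser s p := by
  obtain ⟨ε, hε, hloc⟩ := hX
  intro Y
  obtain ⟨t, ht0, ht1, Z, hZ, hnear⟩ := X.exists_isNear_pts_eq Y hε
  have hmin := (energy_le_energy_iff hp hsp X Z).1 (hloc Z hnear)
  have hconv : (Z.energy s p).toReal ≤ (1 - t) * (X.energy s p).toReal
      + t * (Y.energy s p).toReal := by
    rw [energy, hZ]
    exact (convexOn_jumpEnergy hp hsp).2 X.pts_mem_orderedTuples Y.pts_mem_orderedTuples
      (sub_nonneg.2 ht1) ht0.le (sub_add_cancel 1 t)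
  rw [energy_le_energy_iff hp hsp]
  refine le_of_mul_le_mul_left ?_ ht0
  linarith

end Energy

end Config

end

theorem mainTheorem3 (T : ℕ) (hT : 0 < T) (s p : ℝ) (hp : 1 ≤ p) (hs0 : 0 < s) (hs1 : s < 1)
    (hsp : s * p < 1) :
    (∀ x : Fin T → ℝ, jumpEnergy T s p x ≠ ⊤) ∧
    (∀ X : Config T,
      (X.IsRegular ∧ X.IsCritical s p) ↔ X.IsTranslateOf (Config.equispaced T)) ∧
    (∀ X : Config T, X.IsLocalMinimiser s p ↔ X.IsTranslateOf (Config.equispaced T)) ∧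
    (∀ X : Config T, X.IsGlobalMinimiser s p ↔ X.IsTranslateOf (Config.equispaced T)) := by
  have : NeZero T := ⟨hT.ne'⟩
  have hsp' : s * p ∈ Ioo (0 : ℝ) 1 := ⟨by positivity, hsp⟩
  have hglobal := Config.isGlobalMinimiser_iff_isTranslateOf (T := T) hp hsp'
  refine ⟨jumpEnergy_ne_top hp hsp', fun X => ⟨fun ⟨hreg, hcrit⟩ => ?_, fun hX => ?_⟩,
    fun X => ⟨fun hloc => ?_, fun hX => ?_⟩, hglobal⟩
  · exact (hglobal X).1 (hcrit.isGlobalMinimiser hp hsp' hreg)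
  · exact hX.isRegular_and_isCritical hp hsp'
  · exact (hglobal X).1 (hloc.isGlobalMinimiser hp hsp')
  · exact ⟨1, one_pos, fun Y _ => hX.isGlobalMinimiser hp hsp' Y⟩
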